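/- Let $d\ge 1$ and let $\Omega\subseteq\mathbb R^d$ be a bounded open set with $\Omega=\operatorname{int}(\overline\Omega)$ (for instance a bounded polyhedral Lipschitz domain), whose boundary is divided into pairwise disjoint relatively open sets $\Gamma_D,\Gamma_N,\Gamma_C\subseteq\partial\Omega$ with $|\Gamma_D|>0$ and $\partial\Omega=\overline\Gamma_D\cup\overline\Gamma_N\cup\overline\Gamma_C$. Let $\mathcal T_h$ be a finite conforming triangulation of $\overline\Omega$ into closed nondegenerate $d$-simplices. A side is a $(d-1)$-dimensional face of an element. Interior sides $S\in\mathcal S_h^i$ are those shared by two distinct elements. Boundary sides are those contained in $\partial\Omega$. For $\gamma\in\{\Gamma_D,\Gamma_N,\Gamma_C\}$ let $\mathcal S_h^{\gamma}$ be the set of boundary sides whose relative interior lies in $\gamma$. Assume that every boundary side belongs to $\mathcal S_h^{\Gamma_D}\cup\mathcal S_h^{\Gamma_N}\cup\mathcal S_h^{\Gamma_C}$. Let $\mathcal L^k(\mathcal T_h)$, $k\in\{0,1\}$, be the space of functions that on each element agree a.e. with a polynomial of degree at most $k$, and $\mathcal L^0(\mathcal S_h^{\Gamma_N})$ the space of functions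 that are a.e. constant on each $S\in\mathcal S_h^{\Gamma_N}$. For $v\in\mathcal L^1(\mathcal T_h)$, $v|_T$ denotes the polynomial on the closed simplex $T$, which also gives the trace of $v$ on the sides of $T$, and $\nabla_hv$ is the element-wise gradient. Let $\Pi_h$ be the element-wise integral mean, and let $\pi_h$ be the integral mean on sides. Let $n_T$ be the outward unit normal of $T$. On a boundary side, $v$ and $n$ denote $v|_T$ and $n_T$ for the element $T$ having this side. The Crouzeix–Raviart space $\mathcal S^{1,cr}(\mathcal T_h)$ consists of all $v_h\in\mathcal L^1(\mathcal T_h)$ such that $v_h|_T-v_h|_{T'}$ has vanishing integral mean on every interior side shared by elements $T\ne T'$. $\mathcal S^{1,cr}_D(\mathcal T_h)$ is the subspace of those with $\pi_hv_h=0$ on all sides in $\mathcal S_h^{\Gamma_D}$. The Raviart–Thomas space $\mathcal{R}T^0(\mathcal T_h)$ consists of all $y_h\in(\mathcal L^1(\mathcal T_h))^d$ such that $y_h|_T\cdot n_T$ is constant on each side of each $T\in\mathcal T_h$ and $y_h|_T\cdot n_T+y_h|_{T'}\cdot n_{T'}=0$ on every interior side shared by elements $T\neq T'$. **Lemma A.1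 (lifting).** Let $\overline y_h\in(\mathcal L^0(\mathcal T_h))^d$, $f_h\in\mathcal L^0(\mathcal T_h)$ and $g_h\in\mathcal L^0(\mathcal S_h^{\Gamma_N})$ be such that for every $v_h\in\mathcal S^{1,cr}_D(\mathcal T_h)$ with $\pi_hv_h=0$ on all sides in $\mathcal S_h^{\Gamma_C}$ there holds $$\int_\Omega\overline y_h\cdot\nabla_hv_h\,\mathrm dx-\int_\Omega f_h\,\Pi_hv_h\,\mathrm dx-\sum_{S\in\mathcal S_h^{\Gamma_N}}\int_S g_h\,\pi_hv_h\,\mathrm ds=0 .$$ Then the vector field $y_h$ defined by $$y_h:=\overline y_h-\frac{f_h}{d}\big(\mathrm{id}_{\mathbb R^d}-\Pi_h\mathrm{id}_{\mathbb R^d}\big)\quad\text{a.e. in }\Omega$$ satisfies $y_h\in\mathcal{R}T^0(\mathcal T_h)$. Moreover, $\Pi_hy_h=\overline y_h$ a.e. in $\Omega$; $y_h\in H(\mathrm{div};\Omega)$ with weak divergence $\mathrm{div}\,y_h=-f_h$ a.e. in $\Omega$; and $y_h\cdot n=g_h$ a.e. on every side in $\mathcal S_h^{\Gamma_N}$. 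-/

import Mathlib

open MeasureTheory

open scoped ContDiff

noncomputable section

namespace FEM

/-- The Euclidean space `ℝ^d`. -/
abbrev Eucl (d : ℕ) : Type := EuclideanSpace ℝ (Fin d)

/-- The closed simplex spanned by a finite set of vertices. -/
abbrev hull {d : ℕ} (s : Finset (Eucl d)) : Set (Eucl d) :=
  convexHull ℝ (s : Set (Eucl d))

/-- The `(d-1)`-dimensional surface measure on `ℝ^d`: the `(d-1)`-dimensional Hausdorff measure,
normalized so as to agree with Lebesgue measure on `(d-1)`-dimensional affine subspaces
(for `d = 1` it is the counting measure). -/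
abbrev surface (d : ℕ) : Measure (Eucl d) :=
  Measure.euclideanHausdorffMeasure (d - 1)

/-- A (conforming) triangulation of `Ω ⊆ ℝ^d`: finitely many nondegenerate closed `d`-simplices,
each given by its set of `d + 1` vertices, that cover `closure Ω` exactly, any two of which
intersect in the simplex spanned by their common vertices (empty if there is none). -/
structure Triangulation {d : ℕ} (Ω : Set (Eucl d)) where
  elements : Finset (Finset (Eucl d))
  card_eq : ∀ T ∈ elements, T.card = d + 1
  indep : ∀ T ∈ elements, AffineIndependent ℝ ((↑) : T → Eucl d)
  conforming : ∀ T ∈ elements, ∀ T' ∈ elements,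
    hull T ∩ hull T' = convexHull ℝ ((T : Set (Eucl d)) ∩ (T' : Set (Eucl d)))
  cover : ⋃ T ∈ elements, hull T = closure Ω

/-- `n` is an outward unit normal of the simplex `T` on its side `s`: it is a unit vector,
orthogonal to `s`, and `T` lies in the half space behind `s`. -/
def IsOutwardNormal {d : ℕ} (T s : Finset (Eucl d)) (n : Eucl d) : Prop :=
  ‖n‖ = 1 ∧
  (∀ x ∈ s, ∀ y ∈ s, inner ℝ n (x - y) = 0) ∧
  (∀ x ∈ T, ∀ y ∈ s, inner ℝ n (x - y) ≤ 0)

/-- The outward unit normal vector of the simplex `T` on its side `s`. -/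
def outwardNormal {d : ℕ} (T s : Finset (Eucl d)) : Eucl d :=
  Classical.epsilon (IsOutwardNormal T s)

/-- Sanity check: on a side `s` of a nondegenerate simplex `T` an outward unit normal exists. -/
theorem isOutwardNormal_outwardNormal {d : ℕ} {T s : Finset (Eucl d)}
    (hT : AffineIndependent ℝ ((↑) : T → Eucl d)) (hs : s.Nonempty) (hsT : s ⊆ T)
    (hcard : T.card = s.card + 1) : IsOutwardNormal T s (outwardNormal T s) := by
  refine Classical.epsilon_spec (p := IsOutwardNormal T s) ?_
  classical
  obtain ⟨a, ha, rfl⟩ : ∃ a, a ∉ s ∧ insert a s = T := by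
    have h := (Finset.exists_eq_insert_iff (s := s) (t := T)).2 ⟨hsT, hcard.symm⟩
    obtain ⟨a, ha, h⟩ := h
    exact ⟨a, ha, h⟩
  have hna : a ∉ affineSpan ℝ (s : Set (Eucl d)) := by
    have h := hT.notMem_affineSpan_sdiff ⟨a, by simp⟩ Set.univ
    intro hmem
    apply h
    convert hmem using 2
    ext z
    simp only [Set.mem_image, Set.mem_sdiff, Set.mem_univ, true_and, Set.mem_singleton_iff,
      Subtype.exists, Finset.mem_insert, Finset.mem_coe, Subtype.mk.injEq]
    constructor
    · rintro ⟨z', h1, h2, rfl⟩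
      exact h1.resolve_left h2
    · intro hz
      exact ⟨z, Or.inr hz, fun h => ha (h ▸ hz), rfl⟩
  obtain ⟨b, hb⟩ := hs
  have hbm : b ∈ affineSpan ℝ (s : Set (Eucl d)) := subset_affineSpan ℝ _ hb
  have : Nonempty (affineSpan ℝ (s : Set (Eucl d))) := ⟨⟨b, hbm⟩⟩
  set q := EuclideanGeometry.orthogonalProjection (affineSpan ℝ (s : Set (Eucl d))) a with hq
  have hqm : (q : Eucl d) ∈ affineSpan ℝ (s : Set (Eucl d)) := q.2
  have hne : (q : Eucl d) - a ≠ 0 := fun h => hna (by rw [← sub_eq_zero.1 h]; exact hqm)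
  have horth : ∀ w ∈ (affineSpan ℝ (s : Set (Eucl d))).direction, inner ℝ ((q : Eucl d) - a) w = 0 := by
    intro w hw
    have h := EuclideanGeometry.orthogonalProjection_vsub_mem_direction_orthogonal
      (affineSpan ℝ (s : Set (Eucl d))) a
    rw [Submodule.mem_orthogonal'] at h
    exact h w hw
  have hs0 : ∀ x ∈ affineSpan ℝ (s : Set (Eucl d)), ∀ y ∈ affineSpan ℝ (s : Set (Eucl d)),
      inner ℝ ((q : Eucl d) - a) (x - y) = 0 := fun x hx y hy =>
    horth _ (AffineSubspace.vsub_mem_direction hx hy)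
  refine ⟨‖(q : Eucl d) - a‖⁻¹ • ((q : Eucl d) - a), ?_, ?_, ?_⟩
  · rw [norm_smul, norm_inv, norm_norm, inv_mul_cancel₀ (norm_ne_zero_iff.2 hne)]
  · intro x hx y hy
    rw [real_inner_smul_left, hs0 x (subset_affineSpan ℝ _ hx) y (subset_affineSpan ℝ _ hy),
      mul_zero]
  · intro x hx y hy
    rw [real_inner_smul_left]
    refine mul_nonpos_of_nonneg_of_nonpos (by positivity) ?_
    rcases Finset.mem_insert.1 hx with rfl | hx
    · have h := hs0 q hqm y (subset_affineSpan ℝ _ hy)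
      have e : x - y = -((q : Eucl d) - x) + ((q : Eucl d) - y) := by abel
      rw [e, inner_add_right, h, inner_neg_right, real_inner_self_eq_norm_sq]
      nlinarith [sq_nonneg ‖(q : Eucl d) - x‖]
    · exact (hs0 x (subset_affineSpan ℝ _ hx) y (subset_affineSpan ℝ _ hy)).le

namespace Triangulation

variable {d : ℕ} {Ω : Set (Eucl d)} {F : Type*} [NormedAddCommGroup F] [NormedSpace ℝ F]

/-! ### Sides -/

/-- `s` is a side, that is, a `(d-1)`-dimensional face, of the element `T`. -/
def IsSideOf (𝒯 : Triangulation Ω) (s T : Finset (Eucl d)) : Prop :=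
  T ∈ 𝒯.elements ∧ s ⊆ T ∧ s.card = d

/-- The interior side `s` is shared by the two distinct elements `T` and `T'`, so that
`hull T ∩ hull T' = hull s`. -/
def IsSharedSide (𝒯 : Triangulation Ω) (s T T' : Finset (Eucl d)) : Prop :=
  𝒯.IsSideOf s T ∧ 𝒯.IsSideOf s T' ∧ T ≠ T'

open scoped Classical in
/-- The (finite) set of all sides of elements. -/
def sides (𝒯 : Triangulation Ω) : Finset (Finset (Eucl d)) :=
  𝒯.elements.biUnion fun T => T.powersetCard d

open scoped Classical in
/-- The set of boundary sides: the sides contained in `∂Ω`. -/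
def boundarySides (𝒯 : Triangulation Ω) : Finset (Finset (Eucl d)) :=
  𝒯.sides.filter fun s => hull s ⊆ frontier Ω

open scoped Classical in
/-- The set of boundary sides whose relative interior is contained in `Γ ⊆ ∂Ω`. -/
def sidesIn (𝒯 : Triangulation Ω) (Γ : Set (Eucl d)) : Finset (Finset (Eucl d)) :=
  𝒯.boundarySides.filter fun s => intrinsicInterior ℝ (hull s) ⊆ Γ

/-- An element having `s` as a side (the only one if `s` is a boundary side). -/
def adjacent (𝒯 : Triangulation Ω) (s : Finset (Eucl d)) : Finset (Eucl d) :=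
  Classical.epsilon fun T => 𝒯.IsSideOf s T

/-! ### Element-wise and side-wise polynomial functions

Functions on `Ω` are represented by functions on `ℝ^d`, whose values matter only almost
everywhere in `Ω`. Essential boundedness is automatic in the classes below. -/

/-- `v ∈ 𝓛⁰(𝒯)`: on every element, `v` is a.e. equal to a constant. -/
def IsElementwiseConst (𝒯 : Triangulation Ω) (v : Eucl d → F) : Prop :=
  ∀ T ∈ 𝒯.elements, ∃ c : F, ∀ᵐ x ∂(volume.restrict (hull T)), v x = c

/-- `v ∈ 𝓛¹(𝒯)`: on every element, `v` is a.e. equal to a polynomial of degree at most one. -/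
def IsElementwiseAffine (𝒯 : Triangulation Ω) (v : Eucl d → F) : Prop :=
  ∀ T ∈ 𝒯.elements, ∃ p : Eucl d →ᵃ[ℝ] F, ∀ᵐ x ∂(volume.restrict (hull T)), v x = p x

/-- `g ∈ 𝓛⁰(M)`: on every side in the set of sides `M`, `g` is a.e. equal to a constant. -/
def IsSidewiseConst (M : Finset (Finset (Eucl d))) (g : Eucl d → ℝ) : Prop :=
  ∀ s ∈ M, ∃ c : ℝ, ∀ᵐ x ∂((surface d).restrict (hull s)), g x = c

/-- The restriction `v|_T` of `v ∈ 𝓛¹(𝒯)` to the closed element `T`: the unique affine function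
which is equal to `v` a.e. on `T`. Evaluated on sides of `T`, it gives the trace of `v` from `T`. -/
def restr (v : Eucl d → F) (T : Finset (Eucl d)) : Eucl d →ᵃ[ℝ] F :=
  Classical.epsilon fun p : Eucl d →ᵃ[ℝ] F => ∀ᵐ x ∂(volume.restrict (hull T)), v x = p x

/-- The function which is equal to `φ T` in the interior of every element `T`
(these interiors are disjoint and cover `Ω` up to a null set). -/
def assemble (𝒯 : Triangulation Ω) (φ : Finset (Eucl d) → Eucl d → F) : Eucl d → F :=
  fun x => ∑ T ∈ 𝒯.elements, (interior (hull T)).indicator (φ T) x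

/-- The local `L²`-projection `Π_h` onto element-wise constant functions:
`Π_h v` is the integral mean of `v` over `T` on every element `T`. -/
def elementMean (𝒯 : Triangulation Ω) (v : Eucl d → F) : Eucl d → F :=
  𝒯.assemble fun T _ => ⨍ x in hull T, v x

/-- The element-wise gradient `∇_h v` of `v ∈ 𝓛¹(𝒯)`. -/
def brokenGradient (𝒯 : Triangulation Ω) (v : Eucl d → ℝ) : Eucl d → Eucl d :=
  𝒯.assemble fun T x => gradient (restr v T) x

/-- The integral mean of a function over the side `s`. -/
def meanOn (s : Finset (Eucl d)) (v : Eucl d → ℝ) : ℝ :=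
  ⨍ x in hull s, v x ∂(surface d)

/-- The value on the boundary side `s` of the local `L²`-projection `π_h v` of `v ∈ 𝓛¹(𝒯)`
onto side-wise constant functions. -/
def sideMean (𝒯 : Triangulation Ω) (v : Eucl d → ℝ) (s : Finset (Eucl d)) : ℝ :=
  meanOn s (restr v (𝒯.adjacent s))

/-- The normal component `y|_T · n_T` on the side `s` of the element `T`. -/
def normalComponent (y : Eucl d → Eucl d) (T s : Finset (Eucl d)) (x : Eucl d) : ℝ :=
  inner ℝ (restr y T x) (outwardNormal T s)

/-- The Crouzeix-Raviart space: element-wise affine functions whose jump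
`v|_T - v|_T'` across every interior side has vanishing integral mean. -/
def IsCR (𝒯 : Triangulation Ω) (v : Eucl d → ℝ) : Prop :=
  𝒯.IsElementwiseAffine v ∧
  ∀ s T T', 𝒯.IsSharedSide s T T' → meanOn s (fun x => restr v T x - restr v T' x) = 0

/-- The Crouzeix-Raviart space with homogeneous Dirichlet condition `π_h v = 0` on `ΓD`. -/
def IsCRD (𝒯 : Triangulation Ω) (ΓD : Set (Eucl d)) (v : Eucl d → ℝ) : Prop :=
  𝒯.IsCR v ∧ ∀ s ∈ 𝒯.sidesIn ΓD, 𝒯.sideMean v s = 0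

/-- The lowest order Raviart-Thomas space: element-wise affine vector fields whose normal
components are constant on each side of each element, and whose normal jumps
`y|_T · n_T + y|_T' · n_T'` vanish on all interior sides. -/
def IsRT (𝒯 : Triangulation Ω) (y : Eucl d → Eucl d) : Prop :=
  𝒯.IsElementwiseAffine y ∧
  (∀ s T, 𝒯.IsSideOf s T → ∃ c : ℝ, ∀ x ∈ hull s, normalComponent y T s x = c) ∧
  ∀ s T T', 𝒯.IsSharedSide s T T' →
    ∀ x ∈ hull s, normalComponent y T s x + normalComponent y T' s x = 0

end Triangulation

/-- `y ∈ H(div; Ω)` with (weak) divergence `div y = w` a.e. in `Ω`. -/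
def HasWeakDiv {d : ℕ} (Ω : Set (Eucl d)) (y : Eucl d → Eucl d) (w : Eucl d → ℝ) : Prop :=
  MemLp y 2 (volume.restrict Ω) ∧ MemLp w 2 (volume.restrict Ω) ∧
  ∀ φ : Eucl d → ℝ, ContDiff ℝ ∞ φ → HasCompactSupport φ → tsupport φ ⊆ Ω →
    ∫ x in Ω, inner ℝ (y x) (gradient φ x) = - ∫ x in Ω, w x * φ x

/-- `∂Ω` is divided into three disjoint relatively open parts, the Dirichlet part `ΓD` of positive
surface measure, the Neumann part `ΓN` and the contact part `ΓC`. -/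
structure IsBoundaryPartition {d : ℕ} (Ω ΓD ΓN ΓC : Set (Eucl d)) : Prop where
  openD : ∃ U, IsOpen U ∧ ΓD = U ∩ frontier Ω
  openN : ∃ U, IsOpen U ∧ ΓN = U ∩ frontier Ω
  openC : ∃ U, IsOpen U ∧ ΓC = U ∩ frontier Ω
  disjDN : Disjoint ΓD ΓN
  disjDC : Disjoint ΓD ΓC
  disjNC : Disjoint ΓN ΓC
  cover : frontier Ω = closure ΓD ∪ closure ΓN ∪ closure ΓC
  posD : 0 < surface d ΓD

end FEM

end

noncomputable section

namespace FEM

/-! On an element `T` the field is the polynomial `c - (κ/d)(x - x_T)`, with `c`, `κ` the values of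
the two data and `x_T` the barycenter. Its mean is `c`, its divergence is `-κ`, and its normal
component is constant on each side because `x ↦ x·n` is constant there. It remains to control the
normal components across sides.

For a side `s`, the Crouzeix–Raviart basis function equals `1 - d λ_a` on an element containing `s`,
with `a` the vertex opposite to `s`, and vanishes on the other elements. It has mean one on `s` and
mean zero on all other sides, so it is an admissible test function unless `s` lies in the Dirichlet
or contact part. On one element the test yields exactly the area of `s` times the outward flux
(`crBasis_flux`). Summing over elements, the fluxes through `s` add up to the mean of `g` on a
Neumann side, and to zero on a side off the boundary (`sum_flux`). A shared side belongs to exactly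
two elements and a boundary side to one, which gives the vanishing normal jump and the Neumann
value.

The weak divergence follows from `divergence_theorem` on every simplex: after summation the sides
off the boundary drop out by flux balance, and on boundary sides the test function is zero. The
divergence theorem itself reduces to the fields `φ(x)(x - a)` for vertices `a`, which carry flux
only through the side opposite to `a` and are integrated along rays from `a`
(`integral_radial_divergence`). The same identity supplies all integrals of barycentric coordinates.
-/

/-- `T` is the vertex set of a nondegenerate `d`-simplex. -/
structure IsSimplex {d : ℕ} (T : Finset (Eucl d)) : Prop where
  card_eq : T.card = d + 1
  indep : AffineIndependent ℝ ((↑) : T → Eucl d)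

/-! ### Barycentric coordinates, faces and heights of a simplex. -/

open scoped Classical in
/-- The barycentric coordinate of the simplex `T` belonging to its vertex `a`. -/
def bary {d : ℕ} (T : Finset (Eucl d)) (a : Eucl d) : Eucl d →ᵃ[ℝ] ℝ :=
  Classical.epsilon fun p : Eucl d →ᵃ[ℝ] ℝ => ∀ x ∈ T, p x = if x = a then 1 else 0

namespace IsSimplex

variable {d : ℕ} {T : Finset (Eucl d)}

/-- The vertices of a simplex as an affine basis. -/
def basis (hT : IsSimplex T) : AffineBasis T ℝ (Eucl d) :=
  ⟨(↑), hT.indep, by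
    rw [hT.indep.affineSpan_eq_top_iff_card_eq_finrank_add_one]
    simp [hT.card_eq]⟩

theorem coe_basis (hT : IsSimplex T) : (hT.basis : T → Eucl d) = (↑) := rfl

theorem range_basis (hT : IsSimplex T) : Set.range hT.basis = (T : Set (Eucl d)) := by
  rw [coe_basis]; simp

theorem affineSpan_eq_top (hT : IsSimplex T) : affineSpan ℝ (T : Set (Eucl d)) = ⊤ := by
  rw [← hT.range_basis]; exact hT.basis.tot

open scoped Classical in
theorem bary_spec (hT : IsSimplex T) (a : Eucl d) :
    ∀ x ∈ T, bary T a x = if x = a then 1 else 0 := by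
  refine Classical.epsilon_spec
    (p := fun p : Eucl d →ᵃ[ℝ] ℝ => ∀ x ∈ T, p x = if x = a then 1 else 0) ?_
  by_cases ha : a ∈ T
  · refine ⟨hT.basis.coord ⟨a, ha⟩, fun x hx => ?_⟩
    have h := hT.basis.coord_apply ⟨a, ha⟩ ⟨x, hx⟩
    rw [coe_basis] at h
    rw [h]
    simp [eq_comm]
  · refine ⟨0, fun x hx => ?_⟩
    rw [if_neg (ne_of_mem_of_not_mem hx ha)]
    rfl

theorem bary_self (hT : IsSimplex T) {a : Eucl d} (ha : a ∈ T) : bary T a a = 1 := by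
  rw [hT.bary_spec a a ha, if_pos rfl]

theorem bary_of_ne (hT : IsSimplex T) {a x : Eucl d} (hx : x ∈ T) (h : x ≠ a) :
    bary T a x = 0 := by
  rw [hT.bary_spec a x hx, if_neg h]

/-- Affine maps are determined by their values at the vertices. -/
theorem affine_ext (hT : IsSimplex T) {F : Type*} [AddCommGroup F] [Module ℝ F]
    {p q : Eucl d →ᵃ[ℝ] F} (h : ∀ x ∈ T, p x = q x) : p = q := by
  refine AffineMap.ext_on hT.affineSpan_eq_top fun x hx => h x hx

theorem bary_eq_coord (hT : IsSimplex T) (a : T) : bary T a = hT.basis.coord a := by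
  classical
  refine hT.affine_ext fun x hx => ?_
  rw [hT.bary_spec _ x hx]
  have h := hT.basis.coord_apply a ⟨x, hx⟩
  rw [coe_basis] at h
  rw [h]
  simp [Subtype.ext_iff, eq_comm]

theorem sum_bary (hT : IsSimplex T) (x : Eucl d) : ∑ a ∈ T, bary T a x = 1 := by
  rw [← Finset.sum_coe_sort, ← hT.basis.sum_coord_apply_eq_one x]
  exact Finset.sum_congr rfl fun a _ => by rw [bary_eq_coord]

theorem sum_bary_smul (hT : IsSimplex T) (x : Eucl d) : ∑ a ∈ T, bary T a x • a = x := by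
  rw [← Finset.sum_coe_sort]
  conv_rhs => rw [← hT.basis.linear_combination_coord_eq_self x]
  exact Finset.sum_congr rfl fun a _ => by rw [bary_eq_coord]; rfl

theorem mem_hull (hT : IsSimplex T) {x : Eucl d} : x ∈ hull T ↔ ∀ a ∈ T, 0 ≤ bary T a x := by
  rw [hull, ← hT.range_basis, hT.basis.convexHull_eq_nonneg_coord]
  simp only [Set.mem_ofPred_eq, ← bary_eq_coord, Subtype.forall]

theorem mem_interior_hull (hT : IsSimplex T) {x : Eucl d} :
    x ∈ interior (hull T) ↔ ∀ a ∈ T, 0 < bary T a x := by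
  rw [hull, ← hT.range_basis, hT.basis.interior_convexHull]
  simp only [Set.mem_ofPred_eq, ← bary_eq_coord, Subtype.forall]

theorem interior_nonempty (hT : IsSimplex T) : (interior (hull T)).Nonempty := by
  rw [interior_convexHull_nonempty_iff_affineSpan_eq_top]
  exact hT.affineSpan_eq_top

/-- If the coordinates outside `s` vanish, the expansion of `x` in the vertices is already a convex
combination of points of `s`. -/
theorem mem_hull_of_subset (hT : IsSimplex T) {s : Finset (Eucl d)} (hs : s ⊆ T) {x : Eucl d} :
    x ∈ hull s ↔ (∀ a ∈ T, 0 ≤ bary T a x) ∧ ∀ a ∈ T, a ∉ s → bary T a x = 0 := by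
  classical
  constructor
  · intro hx
    refine ⟨hT.mem_hull.1 (convexHull_mono (Finset.coe_subset.2 hs) hx), fun a _ ha => ?_⟩
    have h1 : hull s ⊆ {x | bary T a x = 0} := by
      refine convexHull_min (fun y hy => hT.bary_of_ne (hs hy) fun h => ha (h ▸ hy)) ?_
      have := (convex_singleton (𝕜 := ℝ) (0 : ℝ)).affine_preimage (bary T a)
      exact this
    exact h1 hx
  · rintro ⟨h0, h1⟩
    have e1 := hT.sum_bary x
    have e2 := hT.sum_bary_smul x
    rw [← Finset.sum_subset hs fun a ha has => h1 a ha has] at e1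
    rw [← Finset.sum_subset hs fun a ha has => by rw [h1 a ha has, zero_smul]] at e2
    rw [← e2]
    exact (convex_convexHull ℝ _).sum_mem (fun a ha => h0 a (hs ha)) e1
      fun a ha => subset_convexHull ℝ _ ha

theorem mem_hull_side (hT : IsSimplex T) {s : Finset (Eucl d)} {a : Eucl d} (ha : a ∉ s)
    (h : T = insert a s) {x : Eucl d} :
    x ∈ hull s ↔ bary T a x = 0 ∧ ∀ b ∈ s, 0 ≤ bary T b x := by
  subst h
  rw [hT.mem_hull_of_subset (Finset.subset_insert a s)]
  constructor
  · rintro ⟨h0, h1⟩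
    exact ⟨h1 a (by simp) ha, fun b hb => h0 b (by simp [hb])⟩
  · rintro ⟨h0, h1⟩
    refine ⟨fun b hb => ?_, fun b hb hbs => ?_⟩
    · rcases Finset.mem_insert.1 hb with rfl | hb
      · exact h0.ge
      · exact h1 b hb
    · rcases Finset.mem_insert.1 hb with rfl | hb
      · exact h0
      · exact absurd hb hbs

/-- The outward normal of a side is a multiple of the gradient of the barycentric coordinate
of the opposite vertex. -/
theorem exists_height (hT : IsSimplex T) {s : Finset (Eucl d)} {a : Eucl d} (ha : a ∉ s)
    (h : T = insert a s) (hs : s.Nonempty) :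
    ∃ η : ℝ, 0 < η ∧ ‖outwardNormal T s‖ = 1 ∧ ∀ x, ∀ y ∈ hull s,
      inner ℝ (outwardNormal T s) (x - y) = -η * bary T a x := by
  obtain ⟨n1, n2, n3⟩ := isOutwardNormal_outwardNormal hT.indep hs
    (h ▸ Finset.subset_insert a s) (by rw [h, Finset.card_insert_of_notMem ha])
  set n := outwardNormal T s
  obtain ⟨b, hb⟩ := hs
  have haT : a ∈ T := h ▸ Finset.mem_insert_self a s
  have hbT : b ∈ T := h ▸ Finset.mem_insert_of_mem hb
  let p : Eucl d →ᵃ[ℝ] ℝ := (innerₛₗ ℝ n).toAffineMap.comp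
    (AffineMap.id ℝ (Eucl d) - AffineMap.const ℝ (Eucl d) b)
  have hp : ∀ x, p x = inner ℝ n (x - b) := fun x => rfl
  -- Both affine functions vanish at the vertices of `s` and have the same value at `a`.
  have e : p = (inner ℝ n (a - b)) • bary T a := by
    refine hT.affine_ext fun x hx => ?_
    rw [hp, AffineMap.coe_smul, Pi.smul_apply, smul_eq_mul]
    by_cases hxa : x = a
    · rw [hxa, hT.bary_self haT, mul_one]
    · rw [hT.bary_of_ne hx hxa, mul_zero]
      refine n2 x ?_ b hb
      rw [h] at hx
      exact (Finset.mem_insert.1 hx).resolve_left hxa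
  have e' : ∀ x, inner ℝ n (x - b) = inner ℝ n (a - b) * bary T a x := fun x => by
    rw [← hp, e, AffineMap.coe_smul, Pi.smul_apply, smul_eq_mul]
  refine ⟨-inner ℝ n (a - b), ?_, n1, fun x y hy => ?_⟩
  · rw [neg_pos]
    refine lt_of_le_of_ne (n3 a haT b hb) fun h0 => ?_
    -- A zero height would make `x ↦ n·(x - b)` vanish identically, but its value at `n + b` is one.
    have := e' (n + b)
    rw [h0, zero_mul, add_sub_cancel_right, real_inner_self_eq_norm_sq, n1] at this
    norm_num at this
  · rw [show x - y = (x - b) - (y - b) by abel, inner_sub_right, e' x, e' y,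
      ((hT.mem_hull_side ha h).1 hy).1]
    ring

end IsSimplex

theorem exists_insert_of_side {d : ℕ} {s T : Finset (Eucl d)} (hsT : s ⊆ T)
    (hT : T.card = d + 1) (hs : s.card = d) : ∃ a, a ∉ s ∧ T = insert a s := by
  obtain ⟨a, ha, h⟩ := (Finset.exists_eq_insert_iff (s := s) (t := T)).2 ⟨hsT, by omega⟩
  exact ⟨a, ha, h.symm⟩

/-! ### Slicing along a normal and the divergence theorem for radial fields. -/

/-- Around a point, Euclidean space is the product of the line in direction of a unit vector `n`
and of a Euclidean space of one dimension less. -/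
theorem exists_orthogonal_splitting {k : ℕ} {n : Eucl (k + 1)} (hn : ‖n‖ = 1) (a : Eucl (k + 1)) :
    ∃ ι : Eucl k →ₗᵢ[ℝ] Eucl (k + 1), (∀ z, inner ℝ n (ι z) = 0) ∧
      ∃ Φ : ℝ × Eucl k ≃ᵐ Eucl (k + 1), MeasurePreserving Φ ∧
        ∀ p, Φ p = a + p.1 • n + ι p.2 := by
  obtain ⟨b, hb⟩ := Orthonormal.exists_orthonormalBasis_extension_of_card_eq (𝕜 := ℝ)
    (E := Eucl (k + 1)) (ι := Fin (k + 1)) (by simp) (v := fun _ => n) (s := {0})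
    ⟨fun _ => hn, fun i j hij => absurd (Subsingleton.elim i j) hij⟩
  have hb0 : b 0 = n := hb 0 rfl
  let ι₀ : Eucl k →ₗ[ℝ] Eucl (k + 1) := ∑ i : Fin k,
    (EuclideanSpace.proj i : Eucl k →L[ℝ] ℝ).toLinearMap.smulRight (b i.succ)
  have hι₀ : ∀ z, ι₀ z = ∑ i : Fin k, z i • b i.succ := fun z => by
    simp [ι₀, LinearMap.sum_apply]
  have hnorm : ∀ z, ‖ι₀ z‖ = ‖z‖ := fun z => by
    rw [← sq_eq_sq₀ (norm_nonneg _) (norm_nonneg _), ← real_inner_self_eq_norm_sq, hι₀,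
      EuclideanSpace.norm_sq_eq]
    have : Orthonormal ℝ fun i : Fin k => b i.succ :=
      b.orthonormal.comp _ (Fin.succ_injective k)
    rw [this.inner_sum]
    simp [sq]
  let ι : Eucl k →ₗᵢ[ℝ] Eucl (k + 1) := ⟨ι₀, hnorm⟩
  refine ⟨ι, fun z => ?_, ?_⟩
  · change inner ℝ n (ι₀ z) = 0
    rw [hι₀, inner_sum, ← hb0]
    refine Finset.sum_eq_zero fun i _ => ?_
    rw [real_inner_smul_right, b.orthonormal.2 (Fin.succ_ne_zero i).symm, mul_zero]
  · have m1 : MeasurePreserving (Prod.map id (MeasurableEquiv.toLp 2 (Fin k → ℝ)).symm :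
        ℝ × Eucl k → ℝ × (Fin k → ℝ)) := by
      exact (MeasurePreserving.id volume).prod (PiLp.volume_preserving_ofLp (Fin k))
    have m2 := (volume_preserving_piFinSuccAbove (fun _ : Fin (k + 1) => ℝ) 0).symm
    have m3 := PiLp.volume_preserving_toLp (Fin (k + 1))
    have m4 := b.measurePreserving_repr_symm
    have m5 := measurePreserving_add_left (volume : Measure (Eucl (k + 1))) a
    let Φ : ℝ × Eucl k ≃ᵐ Eucl (k + 1) :=
      ((MeasurableEquiv.refl ℝ).prodCongr (MeasurableEquiv.toLp 2 (Fin k → ℝ)).symm).trans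
      ((MeasurableEquiv.piFinSuccAbove (fun _ : Fin (k + 1) => ℝ) 0).symm.trans
      ((MeasurableEquiv.toLp 2 (Fin (k + 1) → ℝ)).trans
      (b.repr.symm.toHomeomorph.toMeasurableEquiv.trans (MeasurableEquiv.addLeft a))))
    refine ⟨Φ, m5.comp (m4.comp (m3.comp (m2.comp m1))), fun p => ?_⟩
    change a + b.repr.symm (WithLp.toLp 2 (Fin.insertNth 0 p.1 (fun i => p.2 i))) = _
    rw [add_assoc, add_right_inj, ← OrthonormalBasis.sum_repr_symm, Fin.sum_univ_succ]
    change _ = p.1 • n + ι₀ p.2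
    rw [hι₀, ← hb0]
    simp

theorem isCompact_hull {d : ℕ} (s : Finset (Eucl d)) : IsCompact (hull s) :=
  s.finite_toSet.isCompact_convexHull (𝕜 := ℝ)

open scoped Pointwise in
/-- The divergence theorem on a simplex `T` for the fields `x ↦ φ x • (x - a)`, where `a` is a
vertex of `T`, whose only nonzero normal component is the one on the side opposite to `a`. -/
theorem integral_radial_divergence {k : ℕ} {T s : Finset (Eucl (k + 1))} (hT : IsSimplex T)
    {a : Eucl (k + 1)} (ha : a ∉ s) (h : T = insert a s) (hs : s.Nonempty)
    {n : Eucl (k + 1)} {η : ℝ} (hη : 0 < η) (hn : ‖n‖ = 1)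
    (hinner : ∀ x, ∀ y ∈ hull s, inner ℝ n (x - y) = -η * bary T a x)
    {φ : Eucl (k + 1) → ℝ} (hφ : ContDiff ℝ 1 φ) :
    ∫ x in hull T, (fderiv ℝ φ x (x - a) + (k + 1 : ℕ) * φ x) =
      η * ∫ x in hull s, φ x ∂(surface (k + 1)) := by
  obtain ⟨ι, hι, Φ, mΦ, hΦ⟩ := exists_orthogonal_splitting hn a
  obtain ⟨y₀, hy₀⟩ := hs
  have haT : a ∈ T := h ▸ Finset.mem_insert_self a s
  have hy₀' := subset_convexHull ℝ _ (Finset.mem_coe.2 hy₀)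
  -- With the origin at `a`, the coordinate `τ` measures the distance from `a` along `n`, so the
  -- side `s` lies in the slice `τ = η`.
  have hbary_a : ∀ τ z, bary T a (Φ (τ, z)) = 1 - τ / η := fun τ z => by
    have h1 := hinner a y₀ hy₀'
    have h2 := hinner (Φ (τ, z)) y₀ hy₀'
    rw [hT.bary_self haT] at h1
    rw [hΦ, show a + τ • n + ι z - y₀ = (a - y₀) + τ • n + ι z by abel, inner_add_right,
      inner_add_right, h1, hι, real_inner_smul_right, real_inner_self_eq_norm_sq, hn, ← hΦ (τ, z)] at h2
    field_simp
    linarith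
  set w : Eucl k → Eucl (k + 1) := fun z => a + η • n + ι z with hw
  have hwΦ : ∀ z, w z = Φ (η, z) := fun z => (hΦ (η, z)).symm
  have hscale : ∀ R z, Φ (R * η, R • z) = a + R • (w z - a) := fun R z => by
    rw [hΦ, hw]
    simp only [map_smul]
    module
  have hbary_b : ∀ b ∈ s, ∀ R x, bary T b (a + R • (x - a)) = R * bary T b x := fun b hb R x => by
    have := (bary T b).apply_lineMap a x R
    rw [AffineMap.lineMap_apply, AffineMap.lineMap_apply, hT.bary_of_ne haT
      (fun e => ha (e ▸ hb))] at this
    rw [add_comm a]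
    simpa using this
  set K : Set (Eucl k) := w ⁻¹' hull s with hK
  have hwi : Isometry w := (IsometryEquiv.addLeft (a + η • n)).isometry.comp ι.isometry
  have hKc : IsCompact K :=
    hwi.isClosedEmbedding.isCompact_preimage (isCompact_hull s)
  have hKm : MeasurableSet K := hKc.measurableSet
  -- `w` is an isometry onto the hyperplane of `s`, so surface measure on `s` becomes Lebesgue
  -- measure on `K`.
  have hsurf : ∫ x in hull s, φ x ∂(surface (k + 1)) = ∫ z in K, φ (w z) := by
    have hrange : hull s ⊆ Set.range w := fun x hx => by
      obtain ⟨⟨τ, z⟩, rfl⟩ := Φ.surjective x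
      have := ((hT.mem_hull_side ha h).1 hx).1
      rw [hbary_a] at this
      have : τ = η := by field_simp at this; linarith
      exact ⟨z, by rw [hwΦ, this]⟩
    have e := hwi.map_euclideanHausdorffMeasure (d := k)
    have : (surface (k + 1)).restrict (hull s) =
        ((volume : Measure (Eucl k)).map w).restrict (hull s) := by
      rw [← EuclideanSpace.euclideanHausdorffMeasure_eq_volume, e,
        Measure.restrict_restrict (isCompact_hull s).measurableSet,
        Set.inter_eq_left.2 hrange]
      rfl
    rw [this, hwi.isClosedEmbedding.measurableEmbedding.setIntegral_map]
  -- The simplex is a cone with apex `a`: its slice at `R * η` is the copy of `s` scaled by `R`.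
  have hsec : ∀ R, 0 < R → R ≤ 1 → {z | Φ (R * η, z) ∈ hull T} = R • K := fun R hR hR1 => by
    ext z
    rw [Set.mem_smul_set_iff_inv_smul_mem₀ hR.ne', hK, Set.mem_preimage, hT.mem_hull_side ha h]
    have e : z = R • (R⁻¹ • z) := (smul_inv_smul₀ hR.ne' z).symm
    rw [Set.mem_ofPred_eq, hT.mem_hull, h]
    simp only [Finset.mem_insert, forall_eq_or_imp]
    rw [← h, hbary_a, hwΦ, hbary_a, ← hwΦ]
    have h1 : 0 ≤ 1 - R * η / η := by rw [mul_div_cancel_right₀ _ hη.ne']; linarith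
    have h2 : 1 - η / η = 0 := by rw [div_self hη.ne', sub_self]
    simp only [h1, h2, true_and]
    refine forall₂_congr fun b hb => ?_
    conv_lhs => rw [e, hscale, hbary_b b hb]
    exact mul_nonneg_iff_of_pos_left hR
  set ψ : Eucl (k + 1) → ℝ := fun x => fderiv ℝ φ x (x - a) + (k + 1 : ℕ) * φ x with hψ
  have hφ' : Continuous (fderiv ℝ φ) := hφ.continuous_fderiv one_ne_zero
  have hφc : Continuous φ := hφ.continuous
  have hψc : Continuous ψ := by fun_prop
  have hTc : IsCompact (hull T) := isCompact_hull T
  have hint : Integrable ((hull T).indicator ψ) :=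
    (hψc.continuousOn.integrableOn_compact hTc).integrable_indicator hTc.measurableSet
  rw [← integral_indicator hTc.measurableSet, ← mΦ.integral_comp', Measure.volume_eq_prod,
    integral_prod _ (by exact (mΦ.integrable_comp_emb Φ.measurableEmbedding).2 hint)]
  have hG : ∀ τ, 0 < τ → τ ≤ η → ∫ z, (hull T).indicator ψ (Φ (τ, z)) =
      ∫ z in K, (τ / η) ^ k * ψ (a + (τ / η) • (w z - a)) := fun τ h0 h1 => by
    have hR : 0 < τ / η := div_pos h0 hη
    have e := hsec (τ / η) hR ((div_le_one hη).2 h1)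
    have hτ : τ / η * η = τ := div_mul_cancel₀ _ hη.ne'
    rw [hτ] at e
    have e2 : (fun z => (hull T).indicator ψ (Φ (τ, z))) =
        ((τ / η) • K).indicator fun z => ψ (Φ (τ, z)) := by
      rw [← e]; rfl
    have e3 := Measure.setIntegral_comp_smul_of_pos volume (fun z => ψ (Φ (τ, z))) K hR
    rw [e2, integral_indicator (hKm.const_smul₀ _), integral_const_mul]
    simp_rw [← hscale, hτ]
    rw [e3, smul_eq_mul, ← mul_assoc, finrank_euclideanSpace_fin,
      mul_inv_cancel₀ (pow_ne_zero _ hR.ne'), one_mul]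
  -- Slices outside `[0, η]` are empty; `τ = 0` is excluded because the scaling degenerates there,
  -- and it is a null set.
  have hG0 : ∀ τ, τ ≠ 0 → τ ∉ Set.Ioc 0 η → ∫ z, (hull T).indicator ψ (Φ (τ, z)) = 0 := by
    intro τ h0 h1
    refine integral_eq_zero_of_ae (Filter.Eventually.of_forall fun z => ?_)
    refine Set.indicator_of_notMem (fun hx => h1 ?_) _
    rw [hT.mem_hull] at hx
    have h2 := hx a haT
    have h3 : bary T a (Φ (τ, z)) ≤ 1 := by
      rw [← hT.sum_bary (Φ (τ, z))]
      exact Finset.single_le_sum hx haT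
    rw [hbary_a] at h2 h3
    refine ⟨lt_of_le_of_ne ?_ (Ne.symm h0), (div_le_one hη).1 (by linarith)⟩
    have : 0 ≤ τ / η := by linarith
    rwa [le_div_iff₀ hη, zero_mul] at this
  rw [← setIntegral_eq_integral_of_ae_compl_eq_zero (s := Set.Ioc 0 η)]
  swap
  · filter_upwards [compl_mem_ae_iff.2 (measure_singleton (0 : ℝ))] with τ h0 h1 using hG0 τ h0 h1
  rw [setIntegral_congr_fun measurableSet_Ioc fun τ hτ => hG τ hτ.1 hτ.2,
    integral_integral_swap, hsurf, ← integral_const_mul]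
  · refine setIntegral_congr_fun hKm fun z _ => ?_
    change ∫ τ in Set.Ioc 0 η, _ = _
    rw [← intervalIntegral.integral_of_le hη.le]
    -- The Jacobian `(τ/η)^k` of the slices turns the integrand into an exact derivative along each
    -- ray. Its primitive vanishes at the apex and equals `η φ` on `s`.
    have hd : ∀ τ, HasDerivAt (fun τ => η * (τ / η) ^ (k + 1) * φ (a + (τ / η) • (w z - a)))
        ((τ / η) ^ k * ψ (a + (τ / η) • (w z - a))) τ := fun τ => by
      have d1 : HasDerivAt (fun τ : ℝ => τ / η) (1 / η) τ := (hasDerivAt_id τ).div_const η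
      have d2 : HasDerivAt (fun τ : ℝ => a + (τ / η) • (w z - a)) ((1 / η) • (w z - a)) τ :=
        (d1.smul_const _).const_add _
      have d3 := ((hφ.differentiable one_ne_zero) _).hasFDerivAt.comp_hasDerivAt τ d2
      have d4 := ((d1.pow (k + 1)).const_mul η).mul d3
      refine d4.congr_deriv ?_
      simp only [hψ, add_sub_cancel_left, map_smul, smul_eq_mul, Nat.add_sub_cancel, Function.comp, Pi.pow_apply]
      linear_combination (((k + 1 : ℕ) : ℝ) * (τ / η) ^ k * φ (a + (τ / η) • (w z - a)) +
        (τ / η) ^ (k + 1) * fderiv ℝ φ (a + (τ / η) • (w z - a)) (w z - a)) *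
        mul_one_div_cancel hη.ne'
    rw [intervalIntegral.integral_eq_sub_of_hasDerivAt (fun τ _ => hd τ)]
    · simp [div_self hη.ne']
    · refine Continuous.intervalIntegrable ?_ _ _
      fun_prop
  · rw [Measure.prod_restrict]
    refine IntegrableOn.mono_set ?_ (Set.prod_mono_left Set.Ioc_subset_Icc_self)
    refine ContinuousOn.integrableOn_compact (isCompact_Icc.prod hKc) ?_
    have := hwi.continuous
    refine Continuous.continuousOn ?_
    simp only [Function.uncurry_def]
    fun_prop

/-! ### Derivatives of affine maps. -/

theorem hasFDerivAt_affine {d : ℕ} (p : Eucl d →ᵃ[ℝ] ℝ) (x : Eucl d) :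
    HasFDerivAt p p.linear.toContinuousLinearMap x := by
  have : (p : Eucl d → ℝ) = fun x => p.linear.toContinuousLinearMap x + p 0 := by
    funext x
    conv_lhs => rw [p.decomp]
    rfl
  rw [this]
  exact (ContinuousLinearMap.hasFDerivAt _).add_const _

theorem contDiff_affine {d : ℕ} {F : Type*} [NormedAddCommGroup F] [NormedSpace ℝ F]
    (p : Eucl d →ᵃ[ℝ] F) {m : WithTop ℕ∞} : ContDiff ℝ m p := by
  have : (p : Eucl d → F) = fun x => p.linear.toContinuousLinearMap x + p 0 := by
    funext x
    conv_lhs => rw [p.decomp]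
    rfl
  rw [this]
  exact (ContinuousLinearMap.contDiff _).add contDiff_const

theorem inner_gradient_affine {d : ℕ} (p : Eucl d →ᵃ[ℝ] ℝ) (x w : Eucl d) :
    inner ℝ w (gradient p x) = p.linear w := by
  rw [real_inner_comm, gradient, InnerProductSpace.toDual_symm_apply,
    (hasFDerivAt_affine p x).fderiv]
  rfl

theorem affine_linear_sub {d : ℕ} {F : Type*} [AddCommGroup F] [Module ℝ F]
    (p : Eucl d →ᵃ[ℝ] F) (x y : Eucl d) : p.linear (x - y) = p x - p y :=
  p.linearMap_vsub x y

/-! ### Means of barycentric coordinates and the divergence theorem on a simplex. -/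

/-- The barycenter of a simplex, as an integral mean. -/
abbrev barycenter {d : ℕ} (T : Finset (Eucl d)) : Eucl d := ⨍ x in hull T, x

namespace IsSimplex

variable {d : ℕ} {T s : Finset (Eucl d)}

theorem nonempty_of_card_eq (hd : 1 ≤ d) (hs : s.card = d) : s.Nonempty :=
  Finset.card_pos.1 (by omega)

/-- The opposite vertex and the height belonging to a side of a simplex, with the divergence
theorem for the radial fields emanating from that vertex. -/
theorem exists_opposite (hT : IsSimplex T) (hd : 1 ≤ d) (hsT : s ⊆ T) (hs : s.card = d) :
    ∃ a, a ∉ s ∧ T = insert a s ∧ ∃ η : ℝ, 0 < η ∧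
      (∀ x, ∀ y ∈ hull s, inner ℝ (outwardNormal T s) (x - y) = -η * bary T a x) ∧
      ∀ φ : Eucl d → ℝ, ContDiff ℝ 1 φ →
        ∫ x in hull T, (fderiv ℝ φ x (x - a) + d * φ x) = η * ∫ x in hull s, φ x ∂(surface d) := by
  obtain ⟨a, ha, h⟩ := exists_insert_of_side hsT hT.card_eq hs
  obtain ⟨η, hη, hn, hinner⟩ := hT.exists_height ha h (nonempty_of_card_eq hd hs)
  refine ⟨a, ha, h, η, hη, hinner, fun φ hφ => ?_⟩
  obtain ⟨k, rfl⟩ : ∃ k, d = k + 1 := ⟨d - 1, by omega⟩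
  exact integral_radial_divergence hT ha h (nonempty_of_card_eq hd hs) hη hn hinner hφ

theorem measureReal_pos (hT : IsSimplex T) : 0 < volume.real (hull T) := by
  refine ENNReal.toReal_pos ?_ (isCompact_hull T).measure_lt_top.ne
  exact ((isOpen_interior.measure_pos volume hT.interior_nonempty).trans_le
    (measure_mono interior_subset)).ne'

/-- The radial identity for `φ = 1`: volume is height times base over `d`. -/
theorem volume_eq (hη : ∀ φ : Eucl d → ℝ, ContDiff ℝ 1 φ →
      ∫ x in hull T, (fderiv ℝ φ x (x - a) + d * φ x) = η * ∫ x in hull s, φ x ∂(surface d)) :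
    d * volume.real (hull T) = η * (surface d).real (hull s) := by
  have := hη (fun _ => 1) contDiff_const
  simpa [mul_comm] using this

theorem surface_real_pos (hT : IsSimplex T) (hd : 1 ≤ d) (hsT : s ⊆ T) (hs : s.card = d) :
    0 < (surface d).real (hull s) := by
  obtain ⟨a, ha, h, η, hη, hinner, hdiv⟩ := hT.exists_opposite hd hsT hs
  have h1 := volume_eq hdiv
  have h2 := hT.measureReal_pos
  have h3 : (0 : ℝ) < d := by exact_mod_cast hd
  exact pos_of_mul_pos_right (h1 ▸ mul_pos h3 h2) hη.le

theorem surface_ne_top (hT : IsSimplex T) (hd : 1 ≤ d) (hsT : s ⊆ T) (hs : s.card = d) :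
    surface d (hull s) ≠ ⊤ := fun h => by
  have := hT.surface_real_pos hd hsT hs
  simp [Measure.real, h] at this

theorem integrableOn_side (hT : IsSimplex T) (hd : 1 ≤ d) (hsT : s ⊆ T) (hs : s.card = d)
    {φ : Eucl d → ℝ} (hφ : Continuous φ) : IntegrableOn φ (hull s) (surface d) :=
  hφ.continuousOn.integrableOn_of_subset_isCompact (isCompact_hull s)
    (isCompact_hull s).measurableSet subset_rfl (hT.surface_ne_top hd hsT hs)

theorem integrableOn_hull {F : Type*} [NormedAddCommGroup F] {φ : Eucl d → F}
    (hφ : Continuous φ) : IntegrableOn φ (hull T) :=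
  hφ.continuousOn.integrableOn_compact (isCompact_hull T)

/-- For affine `p` one has `Dp(x - a) = p x - p a`, so the radial identity links the integrals of
`p` over `T` and over `s` with the vertex value `p a`. -/
theorem integral_bary_add
    (hη : ∀ φ : Eucl d → ℝ, ContDiff ℝ 1 φ →
      ∫ x in hull T, (fderiv ℝ φ x (x - a) + d * φ x) = η * ∫ x in hull s, φ x ∂(surface d))
    (p : Eucl d →ᵃ[ℝ] ℝ) :
    (d + 1) * (∫ x in hull T, p x) - p a * volume.real (hull T) =
      η * ∫ x in hull s, p x ∂(surface d) := by
  rw [← hη p (contDiff_affine p)]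
  have e : ∀ x, fderiv ℝ p x (x - a) + d * p x = (d + 1) * p x - p a := fun x => by
    rw [(hasFDerivAt_affine p x).fderiv]
    change p.linear (x - a) + _ = _
    rw [affine_linear_sub]
    ring
  simp_rw [e]
  have hp : Continuous p := (contDiff_affine p (m := 0)).continuous
  rw [integral_sub (integrableOn_hull (by fun_prop)) (integrableOn_hull (by fun_prop)),
    integral_const_mul]
  simp [mul_comm]

/-- The coordinate of `a` vanishes on the opposite side, which removes the surface term. -/
theorem integral_bary (hT : IsSimplex T) (hd : 1 ≤ d) {a : Eucl d} (ha : a ∈ T) :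
    (d + 1) * ∫ x in hull T, bary T a x = volume.real (hull T) := by
  obtain ⟨b, hb, h, η, hη, hinner, hdiv⟩ := hT.exists_opposite (s := T.erase a) hd
    (Finset.erase_subset a T) (by rw [Finset.card_erase_of_mem ha, hT.card_eq]; rfl)
  have hab : b = a := by
    by_contra hne
    exact hb (Finset.mem_erase.2 ⟨hne, h ▸ Finset.mem_insert_self _ _⟩)
  subst hab
  have := integral_bary_add hdiv (bary T b)
  rw [hT.bary_self ha, one_mul, setIntegral_congr_fun (isCompact_hull _).measurableSet
    fun x hx => ((hT.mem_hull_side hb h).1 hx).1, integral_zero, mul_zero] at this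
  linarith

/-- Here the vertex term vanishes instead, since `b` is not the vertex opposite to `s`. -/
theorem integral_side_bary (hT : IsSimplex T) (hd : 1 ≤ d) (hsT : s ⊆ T) (hs : s.card = d)
    {b : Eucl d} (hb : b ∈ s) :
    d * ∫ x in hull s, bary T b x ∂(surface d) = (surface d).real (hull s) := by
  obtain ⟨a, ha, h, η, hη, hinner, hdiv⟩ := hT.exists_opposite hd hsT hs
  have h1 := integral_bary_add hdiv (bary T b)
  have haT : a ∈ T := h ▸ Finset.mem_insert_self _ _
  rw [hT.bary_of_ne haT (ne_of_mem_of_not_mem hb ha).symm, hT.integral_bary hd (hsT hb)] at h1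
  have h2 := volume_eq hdiv
  refine mul_left_cancel₀ hη.ne' ?_
  rw [← h2]
  linear_combination (-(d : ℝ)) * h1

theorem affine_barycenter (hT : IsSimplex T) {F : Type*} [NormedAddCommGroup F] [NormedSpace ℝ F]
    [CompleteSpace F] (p : Eucl d →ᵃ[ℝ] F) :
    ⨍ x in hull T, p x = p (barycenter T) := by
  obtain ⟨L, b, e⟩ : ∃ (L : Eucl d →L[ℝ] F) (b : F), ∀ x, p x = L x + b :=
    ⟨p.linear.toContinuousLinearMap, p 0, fun x => congrFun p.decomp x⟩
  have hV := hT.measureReal_pos.ne'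
  simp_rw [e, barycenter, setAverage_eq]
  rw [integral_add (integrableOn_hull (by fun_prop)) (integrableOn_hull (by fun_prop)),
    ContinuousLinearMap.integral_comp_comm (φ := fun x => x) _ (integrableOn_hull continuous_id),
    map_smul, smul_add]
  simp [smul_smul, hV]

theorem bary_barycenter (hT : IsSimplex T) (hd : 1 ≤ d) {a : Eucl d} (ha : a ∈ T) :
    (d + 1) * bary T a (barycenter T) = 1 := by
  rw [← hT.affine_barycenter, setAverage_eq, smul_eq_mul]
  have := hT.integral_bary hd ha
  have hV := hT.measureReal_pos.ne'
  field_simp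
  linarith

/-- The divergence theorem on a simplex, for affine vector fields `Y` with constant
normal components. -/
theorem divergence_theorem (hT : IsSimplex T) (hd : 1 ≤ d) {Y : Eucl d → Eucl d}
    {c m : Eucl d} {κ : ℝ} (hY : ∀ x, Y x = c - (κ / d) • (x - m))
    {fl : Finset (Eucl d) → ℝ}
    (hfl : ∀ s ⊆ T, s.card = d → ∀ x ∈ hull s, inner ℝ (Y x) (outwardNormal T s) = fl s)
    {φ : Eucl d → ℝ} (hφ : ContDiff ℝ 1 φ) :
    ∫ x in hull T, (fderiv ℝ φ x (Y x) - κ * φ x) =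
      ∑ s ∈ T.powersetCard d, fl s * ∫ x in hull s, φ x ∂(surface d) := by
  set σ : ℝ := -(κ / d)
  have hd0 : (d : ℝ) ≠ 0 := by exact_mod_cast (by omega : d ≠ 0)
  -- Coefficients with sum `σ` and with `∑ C a • a = -Y 0`: coordinate vectors of points have sum
  -- one, so the difference of those of `-Y 0` and `0` has sum zero, and `σ` times those of `0`
  -- corrects the sum without changing the vector.
  set C : Eucl d → ℝ := fun a => bary T a (-Y 0) - bary T a 0 + σ * bary T a 0 with hC
  have hC1 : ∑ a ∈ T, C a = σ := by
    simp only [hC, Finset.sum_add_distrib, Finset.sum_sub_distrib, ← Finset.mul_sum, hT.sum_bary]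
    ring
  have hC2 : ∑ a ∈ T, C a • a = -Y 0 := by
    simp only [hC, add_smul, sub_smul, mul_smul, Finset.sum_add_distrib, Finset.sum_sub_distrib,
      ← Finset.smul_sum, hT.sum_bary_smul]
    simp
  have hYC : ∀ x, Y x = ∑ a ∈ T, C a • (x - a) := fun x => by
    simp only [smul_sub, Finset.sum_sub_distrib, ← Finset.sum_smul, hC1, hC2, hY, σ]
    module
  have e : ∀ x, fderiv ℝ φ x (Y x) - κ * φ x =
      ∑ a ∈ T, C a * (fderiv ℝ φ x (x - a) + d * φ x) := fun x => by
    rw [hYC, map_sum]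
    simp only [map_smul, mul_add, Finset.sum_add_distrib, smul_eq_mul, ← Finset.sum_mul, hC1]
    simp only [σ]
    field_simp
    ring
  have hφ' : Continuous (fderiv ℝ φ) := hφ.continuous_fderiv one_ne_zero
  have hφc : Continuous φ := hφ.continuous
  simp_rw [e]
  rw [integral_finsetSum _ fun a _ => integrableOn_hull (by fun_prop)]
  -- Vertices correspond to their opposite sides.
  refine Finset.sum_bij (fun a _ => T.erase a) (fun a ha => ?_)
    (fun a ha b hb hab => Finset.erase_injOn T ha hb hab) (fun s hs => ?_) fun a ha => ?_
  · rw [Finset.mem_powersetCard, Finset.card_erase_of_mem ha, hT.card_eq]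
    exact ⟨Finset.erase_subset a T, rfl⟩
  · obtain ⟨hs1, hs2⟩ := Finset.mem_powersetCard.1 hs
    obtain ⟨a, ha, h⟩ := exists_insert_of_side hs1 hT.card_eq hs2
    exact ⟨a, h ▸ Finset.mem_insert_self a s, by rw [h, Finset.erase_insert ha]⟩
  · have hs1 := Finset.erase_subset a T
    have hs2 : (T.erase a).card = d := by rw [Finset.card_erase_of_mem ha, hT.card_eq]; rfl
    obtain ⟨b, hb, h, η, hη, hinner, hdiv⟩ := hT.exists_opposite hd hs1 hs2
    have hab : b = a := by
      by_contra hne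
      exact hb (Finset.mem_erase.2 ⟨hne, h ▸ Finset.mem_insert_self _ _⟩)
    subst hab
    rw [integral_const_mul, hdiv φ hφ, ← mul_assoc]
    congr 1
    obtain ⟨x, hx⟩ := nonempty_of_card_eq hd hs2
    have hx := subset_convexHull ℝ _ (Finset.mem_coe.2 hx)
    -- On the side opposite to `b` the fields emanating from other vertices are tangential, so the
    -- flux is `C b * η`.
    rw [← hfl _ hs1 hs2 x hx, hYC, sum_inner, Finset.sum_eq_single b]
    · rw [real_inner_smul_left, real_inner_comm, ← neg_sub, inner_neg_right, hinner _ x hx,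
        hT.bary_self ha]
      ring
    · intro z hz hzb
      rw [real_inner_smul_left, real_inner_comm, ← neg_sub, inner_neg_right, hinner _ x hx,
        hT.bary_of_ne hz hzb]
      ring
    · exact fun h => absurd ha h

end IsSimplex

/-! ### Crouzeix–Raviart basis functions. -/

open scoped Classical in
/-- The restriction to the simplex `T` of the Crouzeix-Raviart basis function of the side `s`. -/
def crBasis {d : ℕ} (s T : Finset (Eucl d)) : Eucl d →ᵃ[ℝ] ℝ :=
  if s ⊆ T then AffineMap.const ℝ (Eucl d) (1 : ℝ) - (d : ℝ) • ∑ a ∈ T \ s, bary T a else 0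

namespace IsSimplex

variable {d : ℕ} {T s : Finset (Eucl d)}

theorem crBasis_of_not_subset (h : ¬ s ⊆ T) : crBasis s T = 0 := if_neg h

theorem crBasis_eq {a : Eucl d} (ha : a ∉ s) (h : T = insert a s) :
    crBasis s T = AffineMap.const ℝ (Eucl d) (1 : ℝ) - (d : ℝ) • bary T a := by
  have : T \ s = {a} := by rw [h, Finset.insert_sdiff_of_notMem _ ha, Finset.sdiff_self]; rfl
  rw [crBasis, if_pos (h ▸ Finset.subset_insert a s)]
  congr 2
  convert Finset.sum_singleton (bary T) a

theorem crBasis_apply {a : Eucl d} (ha : a ∉ s) (h : T = insert a s) (x : Eucl d) :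
    crBasis s T x = 1 - d * bary T a x := by
  rw [crBasis_eq ha h]
  simp [AffineMap.coe_smul]

/-- `λ_a` vanishes on `s` and has mean `1/d` on the other sides of `T`. The case `s ⊄ T` is included
so that the means from all elements at a side agree. -/
theorem meanOn_crBasis (hT : IsSimplex T) (hd : 1 ≤ d) (hs : s.card = d) {s' : Finset (Eucl d)}
    (hs'T : s' ⊆ T) (hs' : s'.card = d) [Decidable (s' = s)] :
    Triangulation.meanOn s' (crBasis s T) = if s' = s then 1 else 0 := by
  have hpos := hT.surface_real_pos hd hs'T hs'
  rw [Triangulation.meanOn, setAverage_eq, smul_eq_mul]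
  by_cases hsT : s ⊆ T
  · obtain ⟨a, ha, h⟩ := exists_insert_of_side hsT hT.card_eq hs
    simp_rw [crBasis_apply ha h]
    split_ifs with hss
    · subst hss
      rw [setIntegral_congr_fun (g := fun _ => 1) (isCompact_hull _).measurableSet fun x hx => by
        simp only [((hT.mem_hull_side ha h).1 hx).1, mul_zero, sub_zero]]
      simp [hpos.ne']
    · have has' : a ∈ s' := by
        by_contra h'
        refine hss (Finset.eq_of_subset_of_card_le (fun x hx => ?_) (by rw [hs, hs']))
        have := hs'T hx
        rw [h] at this
        exact (Finset.mem_insert.1 this).resolve_left (ne_of_mem_of_not_mem hx h')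
      have hc : Continuous (bary T a) := (contDiff_affine _ (m := 0)).continuous
      rw [integral_sub (hT.integrableOn_side hd hs'T hs' (by fun_prop))
        (hT.integrableOn_side hd hs'T hs' (by fun_prop)), integral_const_mul,
        hT.integral_side_bary hd hs'T hs' has']
      simp
  · rw [crBasis_of_not_subset hsT, if_neg (by rintro rfl; exact hsT hs'T)]
    simp

/-- Testing with a Crouzeix-Raviart basis function gives the flux through the side. -/
theorem crBasis_flux (hT : IsSimplex T) (hd : 1 ≤ d) (hsT : s ⊆ T) (hs : s.card = d)
    (c : Eucl d) (κ : ℝ) {x : Eucl d} (hx : x ∈ hull s) :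
    volume.real (hull T) * (crBasis s T).linear c - κ * ∫ x in hull T, crBasis s T x =
      (surface d).real (hull s) *
        inner ℝ (c - (κ / d) • (x - barycenter T)) (outwardNormal T s) := by
  obtain ⟨a, ha, h, η, hη, hinner, hdiv⟩ := hT.exists_opposite hd hsT hs
  have haT : a ∈ T := h ▸ Finset.mem_insert_self a s
  have hd0 : (d : ℝ) ≠ 0 := by exact_mod_cast (by omega : d ≠ 0)
  have h1 := volume_eq hdiv
  have h2 := hT.bary_barycenter hd haT
  have h3 := hT.integral_bary hd haT
  have hxa := ((hT.mem_hull_side ha h).1 hx).1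
  have hc : Continuous (bary T a) := (contDiff_affine _ (m := 0)).continuous
  have e1 : (crBasis s T).linear c = -d * (bary T a).linear c := by
    rw [crBasis_eq ha h]; simp
  have e2 : ∫ x in hull T, crBasis s T x =
      volume.real (hull T) - d * ∫ x in hull T, bary T a x := by
    simp_rw [crBasis_apply ha h]
    rw [integral_sub (integrableOn_hull (by fun_prop)) (integrableOn_hull (by fun_prop)),
      integral_const_mul]
    simp
  -- The outward normal is `-η` times the gradient of `λ_a`.
  have e3 : inner ℝ (outwardNormal T s) c = -η * (bary T a).linear c := by
    have := hinner (x + c) x hx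
    have h' := affine_linear_sub (bary T a) (x + c) x
    rw [add_sub_cancel_left] at this h'
    rw [this, h', hxa, sub_zero]
  have e4 := hinner (barycenter T) x hx
  rw [real_inner_comm, inner_sub_right, real_inner_smul_right, ← neg_sub (barycenter T) x,
    inner_neg_right, e3, e4,
    e1, e2]
  set V := volume.real (hull T)
  set A := (surface d).real (hull s)
  set lin := (bary T a).linear c
  set I := ∫ x in hull T, bary T a x
  set β := bary T a (barycenter T)
  have hd1 : (d : ℝ) + 1 ≠ 0 := by positivity
  have hβ : β = 1 / (d + 1) := by field_simp; linarith
  have hI : I = V / (d + 1) := by field_simp; linarith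
  have hV : V = η * A / d := by field_simp; linarith
  rw [hβ, hI, hV]
  field_simp
  ring

end IsSimplex

/-! ### Two simplices with a common side. -/

/-- The arithmetic mean of the points of `s`. -/
def vertexMean {d : ℕ} (s : Finset (Eucl d)) : Eucl d := (s.card : ℝ)⁻¹ • ∑ x ∈ s, x

theorem affine_vertexMean {d : ℕ} {s : Finset (Eucl d)} (hs : s.Nonempty) (p : Eucl d →ᵃ[ℝ] ℝ) :
    p (vertexMean s) = (s.card : ℝ)⁻¹ * ∑ x ∈ s, p x := by
  obtain ⟨L, b, e⟩ : ∃ (L : Eucl d →ₗ[ℝ] ℝ) (b : ℝ), ∀ x, p x = L x + b :=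
    ⟨p.linear, p 0, fun x => congrFun p.decomp x⟩
  have : (s.card : ℝ) ≠ 0 := by exact_mod_cast (Finset.card_pos.2 hs).ne'
  simp only [e, vertexMean, map_smul, map_sum, Finset.sum_add_distrib, smul_eq_mul, mul_add,
    Finset.sum_const, nsmul_eq_mul]
  rw [inv_mul_cancel_left₀ this]

theorem vertexMean_mem_hull {d : ℕ} {s : Finset (Eucl d)} (hs : s.Nonempty) :
    vertexMean s ∈ hull s := by
  have : (s.card : ℝ) ≠ 0 := by exact_mod_cast (Finset.card_pos.2 hs).ne'
  rw [vertexMean, Finset.smul_sum]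
  exact (convex_convexHull ℝ _).sum_mem (fun _ _ => by positivity) (by simp [this])
    fun x hx => subset_convexHull ℝ _ hx

namespace IsSimplex

variable {d : ℕ} {T T' s : Finset (Eucl d)} {a a' : Eucl d}

/-- Makes the vertex mean a relatively interior point of `s`; the strict inequalities survive small
perturbations. -/
theorem bary_vertexMean_pos (hT : IsSimplex T) (hsT : s ⊆ T) {b : Eucl d} (hb : b ∈ s) :
    0 < bary T b (vertexMean s) := by
  rw [affine_vertexMean ⟨b, hb⟩]
  have : 0 < (s.card : ℝ) := by exact_mod_cast Finset.card_pos.2 ⟨b, hb⟩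
  rw [Finset.sum_eq_single_of_mem b hb fun x hx hxb => hT.bary_of_ne (hsT hx) hxb,
    hT.bary_self (hsT hb)]
  positivity

theorem continuous_bary (T : Finset (Eucl d)) (a : Eucl d) : Continuous (bary T a) :=
  (contDiff_affine _ (m := 0)).continuous

/-- Barycentric coordinates of two simplices with a common side, belonging to the vertices
opposite to that side, are proportional. -/
theorem bary_eq_mul (hT : IsSimplex T) (hT' : IsSimplex T') (ha : a ∉ s) (ha' : a' ∉ s)
    (h : T = insert a s) (h' : T' = insert a' s) (x : Eucl d) :
    bary T a x = bary T a a' * bary T' a' x := by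
  have : bary T a = bary T a a' • bary T' a' := by
    refine hT'.affine_ext fun z hz => ?_
    rw [AffineMap.coe_smul, Pi.smul_apply, smul_eq_mul]
    by_cases hza : z = a'
    · subst hza
      rw [hT'.bary_self hz, mul_one]
    · have hzs : z ∈ s := (Finset.mem_insert.1 (h' ▸ hz)).resolve_left hza
      rw [hT'.bary_of_ne hz hza, mul_zero]
      exact hT.bary_of_ne (h ▸ Finset.mem_insert_of_mem hzs) (ne_of_mem_of_not_mem hzs ha)
  conv_lhs => rw [this]
  rfl

theorem bary_opposite_ne_zero (hT : IsSimplex T) (hT' : IsSimplex T') (ha : a ∉ s) (ha' : a' ∉ s)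
    (h : T = insert a s) (h' : T' = insert a' s) : bary T a a' ≠ 0 := fun h0 => by
  have := hT.bary_eq_mul hT' ha ha' h h' a
  rw [h0, zero_mul, hT.bary_self (h ▸ Finset.mem_insert_self a s)] at this
  exact one_ne_zero this

end IsSimplex

/-! ### Geometry of the triangulation and integration over its elements. -/

namespace Triangulation

variable {d : ℕ} {Ω : Set (Eucl d)} {F : Type*} [NormedAddCommGroup F]
  {𝒯 : Triangulation Ω} {s T T' T'' : Finset (Eucl d)} {a a' : Eucl d}

theorem isSimplex (𝒯 : Triangulation Ω) (hT : T ∈ 𝒯.elements) : IsSimplex T :=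
  ⟨𝒯.card_eq T hT, 𝒯.indep T hT⟩

/-- The intersection is the face spanned by the common vertices, and `a` is not one of them.
Conformity enters the argument only here. -/
theorem bary_eq_zero_of_mem_inter (hT : T ∈ 𝒯.elements) (hT' : T' ∈ 𝒯.elements) (ha : a ∈ T)
    (ha' : a ∉ T') {x : Eucl d} (hx : x ∈ hull T) (hx' : x ∈ hull T') : bary T a x = 0 := by
  have := 𝒯.conforming T hT T' hT' ▸ Set.mem_inter hx hx'
  rw [← Finset.coe_inter] at this
  exact (((𝒯.isSimplex hT).mem_hull_of_subset Finset.inter_subset_left).1 this).2 a ha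
    fun h => ha' (Finset.mem_inter.1 h).2

theorem disjoint_interior (hT : T ∈ 𝒯.elements) (hT' : T' ∈ 𝒯.elements) (hne : T ≠ T') :
    Disjoint (interior (hull T)) (interior (hull T')) := by
  rw [Set.disjoint_left]
  intro x hx hx'
  obtain ⟨a, ha, ha'⟩ : ∃ a ∈ T, a ∉ T' := by
    by_contra! hsub
    exact hne (Finset.eq_of_subset_of_card_le hsub (by rw [𝒯.card_eq T hT, 𝒯.card_eq T' hT']))
  have := bary_eq_zero_of_mem_inter hT hT' ha ha' (interior_subset hx) (interior_subset hx')
  exact (((𝒯.isSimplex hT).mem_interior_hull.1 hx) a ha).ne' this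

theorem hull_subset_closure (hT : T ∈ 𝒯.elements) : hull T ⊆ closure Ω := by
  rw [← 𝒯.cover]
  exact Set.subset_biUnion_of_mem (u := fun T : Finset (Eucl d) => hull T) hT

theorem interior_hull_subset (hΩ : interior (closure Ω) = Ω) (hT : T ∈ 𝒯.elements) :
    interior (hull T) ⊆ Ω :=
  (interior_mono (hull_subset_closure hT)).trans hΩ.subset

theorem interior_hull_ae_eq (T : Finset (Eucl d)) :
    (interior (hull T) : Set (Eucl d)) =ᵐ[volume] hull T :=
  interior_ae_eq_of_null_frontier ((convex_convexHull ℝ _).addHaar_frontier volume)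

/-- Open elements lie in `Ω = int(closure Ω)`, the closed ones cover it, and the boundary of a
convex set is null. -/
theorem ae_restrict_iff (hΩ : interior (closure Ω) = Ω) {P : Eucl d → Prop} :
    (∀ᵐ x ∂(volume.restrict Ω), P x) ↔
      ∀ T ∈ 𝒯.elements, ∀ᵐ x ∂(volume.restrict (hull T)), P x := by
  constructor
  · intro h T hT
    rw [← Measure.restrict_congr_set (interior_hull_ae_eq T)]
    exact ae_restrict_of_ae_restrict_of_subset (interior_hull_subset hΩ hT) h
  · intro h
    refine ae_restrict_of_ae_restrict_of_subset subset_closure ?_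
    rw [← 𝒯.cover]
    exact (ae_restrict_biUnion_finset_iff _ _ _).2 h

theorem setIntegral_eq_sum (hΩ : interior (closure Ω) = Ω) {G : Eucl d → ℝ}
    (hG : ∀ T ∈ 𝒯.elements, IntegrableOn G (hull T)) :
    ∫ x in Ω, G x = ∑ T ∈ 𝒯.elements, ∫ x in hull T, G x := by
  have e : (Ω : Set (Eucl d)) =ᵐ[volume] ⋃ T ∈ 𝒯.elements, interior (hull T) := by
    have hsub : (⋃ T ∈ 𝒯.elements, interior (hull T)) ⊆ Ω :=
      Set.iUnion₂_subset fun T hT => interior_hull_subset hΩ hT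
    refine Filter.EventuallyLE.antisymm ?_ hsub.eventuallyLE
    refine (subset_closure : Ω ⊆ closure Ω).eventuallyLE.trans ?_
    rw [← 𝒯.cover]
    exact (𝒯.elements.eventuallyEq_iUnion fun T _ =>
      interior_hull_ae_eq T).symm.le
  rw [setIntegral_congr_set e, integral_biUnion_finset 𝒯.elements
    (fun T _ => isOpen_interior.measurableSet)
    (fun T hT T' hT' hne => disjoint_interior hT hT' hne)
    fun T hT => (hG T hT).mono_set interior_subset]
  exact Finset.sum_congr rfl fun T _ => setIntegral_congr_set (interior_hull_ae_eq T)

/-- Affine maps that agree a.e. on the nonempty interior of `T` agree everywhere, so the choice in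
`restr` is forced. -/
theorem restr_eq [NormedSpace ℝ F] (hT : IsSimplex T) {v : Eucl d → F} {p : Eucl d →ᵃ[ℝ] F}
    (h : ∀ᵐ x ∂(volume.restrict (hull T)), v x = p x) : restr v T = p := by
  have h' := Classical.epsilon_spec
    (p := fun p : Eucl d →ᵃ[ℝ] F => ∀ᵐ x ∂(volume.restrict (hull T)), v x = p x) ⟨p, h⟩
  have h2 : (restr v T : Eucl d → F) =ᵐ[volume.restrict (interior (hull T))] p := by
    refine ae_restrict_of_ae_restrict_of_subset interior_subset ?_
    filter_upwards [h, h'] with x h1 h2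
    exact h2.symm.trans h1
  have h3 := Measure.eqOn_open_of_ae_eq h2 isOpen_interior
    (contDiff_affine _ (m := 0)).continuous.continuousOn
    (contDiff_affine _ (m := 0)).continuous.continuousOn
  exact AffineMap.ext_on (isOpen_interior.affineSpan_eq_top hT.interior_nonempty) h3

theorem assemble_ae (hT : T ∈ 𝒯.elements) (φ : Finset (Eucl d) → Eucl d → F) :
    ∀ᵐ x ∂(volume.restrict (hull T)), 𝒯.assemble φ x = φ T x := by
  rw [← Measure.restrict_congr_set (interior_hull_ae_eq T)]
  filter_upwards [ae_restrict_mem isOpen_interior.measurableSet] with x hx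
  rw [assemble, Finset.sum_eq_single_of_mem T hT fun T' hT' hne => Set.indicator_of_notMem
    (fun hx' => Set.disjoint_left.1 (disjoint_interior hT' hT hne) hx' hx) _,
    Set.indicator_of_mem hx]

theorem mem_sides : s ∈ 𝒯.sides ↔ ∃ T, 𝒯.IsSideOf s T := by
  simp [sides, IsSideOf]

theorem isSideOf_adjacent (hs : s ∈ 𝒯.sides) : 𝒯.IsSideOf s (𝒯.adjacent s) :=
  Classical.epsilon_spec (p := fun T => 𝒯.IsSideOf s T) (mem_sides.1 hs)

/-- Two elements with a common side lie on different sides of it. -/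
theorem bary_opposite_neg (hT : T ∈ 𝒯.elements) (hT' : T' ∈ 𝒯.elements) (hne : T ≠ T')
    (hs : s.Nonempty) (ha : a ∉ s) (ha' : a' ∉ s) (h : T = insert a s) (h' : T' = insert a' s) :
    bary T a a' < 0 := by
  have hTs := 𝒯.isSimplex hT
  have hTs' := 𝒯.isSimplex hT'
  refine lt_of_le_of_ne (not_lt.1 fun hpos => ?_) (hTs.bary_opposite_ne_zero hTs' ha ha' h h')
  have haT' : a ∉ T' := fun hmem => by
    rw [h'] at hmem
    rcases Finset.mem_insert.1 hmem with rfl | hmem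
    · exact hne (h.trans h'.symm)
    · exact ha hmem
  have hsT : s ⊆ T := h ▸ Finset.subset_insert a s
  -- Moving slightly from inside `s` towards `a'` stays in `T'`. If `λ_a(a')` were positive, the
  -- point would also lie in `T` with `λ_a > 0`, against conformity.
  let q : ℝ → Eucl d := AffineMap.lineMap (vertexMean s) a'
  have hq0 : q 0 = vertexMean s := AffineMap.lineMap_apply_zero _ _
  have hqc : Continuous q := AffineMap.lineMap_continuous
  have h1 : ∀ᶠ ε in nhdsWithin (0 : ℝ) (Set.Ioi 0), ∀ b ∈ s, 0 < bary T b (q ε) := by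
    rw [Filter.eventually_all_finset]
    intro b hb
    refine Filter.Eventually.filter_mono nhdsWithin_le_nhds ?_
    refine ((IsSimplex.continuous_bary T b).comp hqc).continuousAt.eventually_const_lt ?_
    change 0 < bary T b (q 0)
    rw [hq0]
    exact hTs.bary_vertexMean_pos hsT hb
  have h2 : ∀ᶠ ε in nhdsWithin (0 : ℝ) (Set.Ioi 0), ε ∈ Set.Ioo (0 : ℝ) 1 :=
    Ioo_mem_nhdsGT one_pos
  obtain ⟨ε, hε1, hε0, hε2⟩ := (h1.and h2).exists
  have hm := vertexMean_mem_hull hs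
  have hqa : bary T a (q ε) = ε * bary T a a' := by
    have := (bary T a).apply_lineMap (vertexMean s) a' ε
    rw [((hTs.mem_hull_side ha h).1 hm).1] at this
    exact this.trans (by simp [AffineMap.lineMap_apply])
  have hqpos : 0 < bary T a (q ε) := hqa ▸ mul_pos hε0 hpos
  refine hqpos.ne' (bary_eq_zero_of_mem_inter hT hT' (h ▸ Finset.mem_insert_self a s) haT' ?_ ?_)
  · rw [hTs.mem_hull]
    intro b hb
    rw [h] at hb
    rcases Finset.mem_insert.1 hb with rfl | hb
    · exact hqpos.le
    · exact (hε1 b hb).le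
  · exact (convex_convexHull ℝ _).lineMap_mem
      (convexHull_mono (Finset.coe_subset.2 (h' ▸ Finset.subset_insert a' s)) hm)
      (subset_convexHull ℝ _ (by rw [h']; simp)) ⟨hε0.le, hε2.le⟩

/-- A side belongs to at most two elements. -/
theorem eq_or_eq_of_isSharedSide (hd : 1 ≤ d) (h : 𝒯.IsSharedSide s T T')
    (h'' : 𝒯.IsSideOf s T'') : T'' = T ∨ T'' = T' := by
  obtain ⟨⟨hT, hsT, hs⟩, ⟨hT', hsT', -⟩, hne⟩ := h
  obtain ⟨hT'', hsT'', -⟩ := h''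
  by_contra! hcon
  have hsn := IsSimplex.nonempty_of_card_eq hd hs
  obtain ⟨a, ha, e⟩ := exists_insert_of_side hsT (𝒯.card_eq T hT) hs
  obtain ⟨a', ha', e'⟩ := exists_insert_of_side hsT' (𝒯.card_eq T' hT') hs
  obtain ⟨a'', ha'', e''⟩ := exists_insert_of_side hsT'' (𝒯.card_eq T'' hT'') hs
  have h1 := bary_opposite_neg hT hT' hne hsn ha ha' e e'
  have h2 := bary_opposite_neg hT hT'' hcon.1.symm hsn ha ha'' e e''
  have h3 := bary_opposite_neg hT' hT'' hcon.2.symm hsn ha' ha'' e' e''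
  -- Three opposite vertices would lie pairwise on different sides of one hyperplane; the product of
  -- two negative numbers is not negative.
  have := (𝒯.isSimplex hT).bary_eq_mul (𝒯.isSimplex hT') ha ha' e e' a''
  linarith [mul_pos_of_neg_of_neg h1 h3]

/-- A side shared by two elements is not a boundary side. -/
theorem notMem_boundarySides_of_isSharedSide (hΩ : interior (closure Ω) = Ω) (hd : 1 ≤ d)
    (h : 𝒯.IsSharedSide s T T') : s ∉ 𝒯.boundarySides := by
  obtain ⟨⟨hT, hsT, hs⟩, ⟨hT', hsT', -⟩, hne⟩ := h
  have hsn := IsSimplex.nonempty_of_card_eq hd hs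
  obtain ⟨a, ha, e⟩ := exists_insert_of_side hsT (𝒯.card_eq T hT) hs
  obtain ⟨a', ha', e'⟩ := exists_insert_of_side hsT' (𝒯.card_eq T' hT') hs
  have h1 := bary_opposite_neg hT hT' hne hsn ha ha' e e'
  have hTs := 𝒯.isSimplex hT
  have hTs' := 𝒯.isSimplex hT'
  intro hb
  have hfr : hull s ⊆ frontier Ω := by
    classical
    exact (Finset.mem_filter.1 hb).2
  have hΩo : IsOpen Ω := hΩ ▸ isOpen_interior
  have hmem := hfr (vertexMean_mem_hull hsn)
  rw [hΩo.frontier_eq] at hmem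
  refine hmem.2 ?_
  rw [← hΩ, mem_interior_iff_mem_nhds]
  -- Near the vertex mean only the coordinates of `a` and `a'` can be negative. They have opposite
  -- signs, so `T` and `T'` together fill a neighbourhood, which puts the point in `int(closure Ω) =
  -- Ω`.
  have hnhds : ∀ᶠ x in nhds (vertexMean s), ∀ b ∈ s, 0 < bary T b x ∧ 0 < bary T' b x := by
    rw [Filter.eventually_all_finset]
    exact fun b hb =>
      ((IsSimplex.continuous_bary T b).continuousAt.eventually_const_lt
        (hTs.bary_vertexMean_pos hsT hb)).and
      ((IsSimplex.continuous_bary T' b).continuousAt.eventually_const_lt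
        (hTs'.bary_vertexMean_pos hsT' hb))
  filter_upwards [hnhds] with x hx
  have hmul := hTs.bary_eq_mul hTs' ha ha' e e' x
  rcases le_or_gt 0 (bary T a x) with h0 | h0
  · refine hull_subset_closure hT (hTs.mem_hull.2 fun b hb => ?_)
    rw [e] at hb
    rcases Finset.mem_insert.1 hb with rfl | hb
    · exact h0
    · exact (hx b hb).1.le
  · refine hull_subset_closure hT' (hTs'.mem_hull.2 fun b hb => ?_)
    rw [e'] at hb
    rcases Finset.mem_insert.1 hb with rfl | hb
    · by_contra! hneg
      linarith [mul_pos_of_neg_of_neg h1 hneg]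
    · exact (hx b hb).2.le

end Triangulation

/-! ### Fluxes through sides and the test with basis functions. -/

namespace Triangulation

variable {d : ℕ} {Ω : Set (Eucl d)} {F : Type*} [NormedAddCommGroup F]
  {𝒯 : Triangulation Ω} {s T T' : Finset (Eucl d)}

theorem elementMean_ae [NormedSpace ℝ F] (hT : T ∈ 𝒯.elements) {v w : Eucl d → F}
    (h : ∀ᵐ x ∂(volume.restrict (hull T)), v x = w x) :
    ∀ᵐ x ∂(volume.restrict (hull T)), 𝒯.elementMean v x = ⨍ x in hull T, w x := by
  filter_upwards [assemble_ae hT fun T _ => ⨍ x in hull T, v x] with x hx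
  rw [elementMean, hx]
  exact average_congr h

theorem meanOn_sub (hT : IsSimplex T) (hd : 1 ≤ d) (hsT : s ⊆ T) (hs : s.card = d)
    {v w : Eucl d → ℝ} (hv : Continuous v) (hw : Continuous w) :
    meanOn s (fun x => v x - w x) = meanOn s v - meanOn s w := by
  simp only [meanOn, setAverage_eq]
  rw [integral_sub (hT.integrableOn_side hd hsT hs hv) (hT.integrableOn_side hd hsT hs hw),
    smul_sub]

theorem memLp_assemble {G : Finset (Eucl d) → Eucl d → F} (hG : ∀ T, Continuous (G T)) :
    MemLp (𝒯.assemble G) 2 (volume.restrict Ω) := by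
  refine memLp_finsetSum _ fun T _ => ?_
  rw [memLp_indicator_iff_restrict isOpen_interior.measurableSet]
  obtain ⟨C, hC⟩ := (isCompact_hull T).exists_bound_of_continuousOn (hG T).continuousOn
  have hfin : IsFiniteMeasure (volume.restrict (hull T)) :=
    ⟨by simpa using (isCompact_hull T).measure_lt_top⟩
  have h : MemLp (G T) 2 (volume.restrict (hull T)) :=
    MemLp.of_bound (hG T).aestronglyMeasurable C <| by
      filter_upwards [ae_restrict_mem (isCompact_hull T).measurableSet] with x hx using hC x hx
  refine h.mono_measure ?_
  rw [Measure.restrict_restrict isOpen_interior.measurableSet]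
  exact Measure.restrict_mono (Set.inter_subset_left.trans interior_subset) le_rfl

/-- The normal component on `s` of the field `x ↦ c T - (k T / d) • (x - barycenter T)`. -/
def flux (c : Finset (Eucl d) → Eucl d) (k : Finset (Eucl d) → ℝ) (T s : Finset (Eucl d)) : ℝ :=
  inner ℝ (c T - (k T / d) • (vertexMean s - barycenter T)) (outwardNormal T s)

/-- The left side of `crBasis_flux` does not depend on the point `x` of the side, hence neither does
the normal component. -/
theorem inner_outwardNormal_eq_flux (hT : IsSimplex T) (hd : 1 ≤ d) (hsT : s ⊆ T)
    (hs : s.card = d) (c : Finset (Eucl d) → Eucl d) (k : Finset (Eucl d) → ℝ) {x : Eucl d}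
    (hx : x ∈ hull s) :
    inner ℝ (c T - (k T / d) • (x - barycenter T)) (outwardNormal T s) = flux c k T s := by
  have h1 := hT.crBasis_flux hd hsT hs (c T) (k T) hx
  have h2 := hT.crBasis_flux hd hsT hs (c T) (k T)
    (vertexMean_mem_hull (IsSimplex.nonempty_of_card_eq hd hs))
  exact mul_left_cancel₀ (hT.surface_real_pos hd hsT hs).ne' (h1.symm.trans h2)

theorem mem_sidesIn {Γ : Set (Eucl d)} :
    s ∈ 𝒯.sidesIn Γ ↔ s ∈ 𝒯.boundarySides ∧ intrinsicInterior ℝ (hull s) ⊆ Γ := by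
  simp [sidesIn]

theorem sides_of_mem_sidesIn {Γ : Set (Eucl d)} (hs : s ∈ 𝒯.sidesIn Γ) : s ∈ 𝒯.sides := by
  classical
  exact (Finset.mem_filter.1 (mem_sidesIn.1 hs).1).1

theorem notMem_sidesIn_of_disjoint {Γ Γ' : Set (Eucl d)} (hs : s.Nonempty) (h : Disjoint Γ Γ')
    (hΓ : s ∈ 𝒯.sidesIn Γ) : s ∉ 𝒯.sidesIn Γ' := fun hΓ' => by
  obtain ⟨x, hx⟩ := Set.Nonempty.intrinsicInterior (convex_convexHull ℝ (s : Set (Eucl d)))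
    ⟨_, vertexMean_mem_hull hs⟩
  exact Set.disjoint_left.1 h ((mem_sidesIn.1 hΓ).2 hx) ((mem_sidesIn.1 hΓ').2 hx)

open scoped Classical in
/-- The fluxes through a side outside of `ΓD ∪ ΓC` balance the Neumann datum. -/
theorem sum_flux (hd : 1 ≤ d) (hΩ : interior (closure Ω) = Ω) {ΓD ΓN ΓC : Set (Eucl d)}
    {ybar : Eucl d → Eucl d} {c : Finset (Eucl d) → Eucl d}
    (hc : ∀ T ∈ 𝒯.elements, ∀ᵐ x ∂(volume.restrict (hull T)), ybar x = c T)
    {f : Eucl d → ℝ} {k : Finset (Eucl d) → ℝ}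
    (hk : ∀ T ∈ 𝒯.elements, ∀ᵐ x ∂(volume.restrict (hull T)), f x = k T) {g : Eucl d → ℝ}
    (hcompat : ∀ v : Eucl d → ℝ, 𝒯.IsCRD ΓD v → (∀ s ∈ 𝒯.sidesIn ΓC, 𝒯.sideMean v s = 0) →
      (∫ x in Ω, inner ℝ (ybar x) (𝒯.brokenGradient v x))
        - (∫ x in Ω, f x * 𝒯.elementMean v x)
        - (∑ s ∈ 𝒯.sidesIn ΓN, ∫ x in hull s, g x * 𝒯.sideMean v s ∂(surface d)) = 0)
    (hs : s ∈ 𝒯.sides) (hsD : s ∉ 𝒯.sidesIn ΓD) (hsC : s ∉ 𝒯.sidesIn ΓC) :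
    (surface d).real (hull s) * ∑ T ∈ 𝒯.elements with s ⊆ T, flux c k T s =
      if s ∈ 𝒯.sidesIn ΓN then ∫ x in hull s, g x ∂(surface d) else 0 := by
  have hsd : s.card = d := (isSideOf_adjacent hs).2.2
  have hsn := IsSimplex.nonempty_of_card_eq hd hsd
  -- The global basis function of `s`; on elements not containing `s` it is zero.
  set v : Eucl d → ℝ := 𝒯.assemble fun T => crBasis s T with hv
  have hvT : ∀ T ∈ 𝒯.elements, ∀ᵐ x ∂(volume.restrict (hull T)), v x = crBasis s T x :=
    fun T hT => assemble_ae hT _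
  have hrestr : ∀ T ∈ 𝒯.elements, restr v T = crBasis s T := fun T hT =>
    restr_eq (𝒯.isSimplex hT) (hvT T hT)
  have hcont : ∀ T, Continuous (crBasis s T) := fun T => (contDiff_affine _ (m := 0)).continuous
  have hmean : ∀ s' ∈ 𝒯.sides, 𝒯.sideMean v s' = if s' = s then 1 else 0 := fun s' hs' => by
    obtain ⟨h1, h2, h3⟩ := isSideOf_adjacent hs'
    rw [sideMean, hrestr _ h1]
    exact (𝒯.isSimplex h1).meanOn_crBasis hd hsd h2 h3
  have hmean0 : ∀ Γ, s ∉ 𝒯.sidesIn Γ → ∀ s' ∈ 𝒯.sidesIn Γ, 𝒯.sideMean v s' = 0 :=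
    fun Γ hΓ s' hs' => by
      rw [hmean s' (sides_of_mem_sidesIn hs'), if_neg (ne_of_mem_of_not_mem hs' hΓ)]
  have hCR : 𝒯.IsCRD ΓD v := by
    refine ⟨⟨fun T hT => ⟨crBasis s T, hvT T hT⟩, fun s' T T' h => ?_⟩, hmean0 ΓD hsD⟩
    obtain ⟨⟨hT, hsT, hs'⟩, ⟨hT', hsT', -⟩, -⟩ := h
    rw [hrestr T hT, hrestr T' hT',
      meanOn_sub (𝒯.isSimplex hT) hd hsT hs' (hcont T) (hcont T'),
      (𝒯.isSimplex hT).meanOn_crBasis hd hsd hsT hs',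
      (𝒯.isSimplex hT').meanOn_crBasis hd hsd hsT' hs', sub_self]
  have hconst : ∀ T : Finset (Eucl d), ∀ r : ℝ, IntegrableOn (fun _ => r) (hull T) :=
    fun T r => IsSimplex.integrableOn_hull continuous_const
  have h1 : ∀ T ∈ 𝒯.elements, (fun x => inner ℝ (ybar x) (𝒯.brokenGradient v x))
      =ᵐ[volume.restrict (hull T)] fun _ => (crBasis s T).linear (c T) := fun T hT => by
    filter_upwards [hc T hT, assemble_ae hT fun T x => gradient (restr v T) x] with x hx hx'
    rw [brokenGradient, hx', hx, hrestr T hT, inner_gradient_affine]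
  have h2 : ∀ T ∈ 𝒯.elements, (fun x => f x * 𝒯.elementMean v x)
      =ᵐ[volume.restrict (hull T)] fun _ => k T * ⨍ x in hull T, crBasis s T x := fun T hT => by
    filter_upwards [hk T hT, elementMean_ae hT (hvT T hT)] with x hx hx'
    rw [hx, hx']
  have hmain := hcompat v hCR (hmean0 ΓC hsC)
  rw [setIntegral_eq_sum hΩ fun T hT => (hconst T _).congr (h1 T hT).symm,
    setIntegral_eq_sum hΩ fun T hT => (hconst T _).congr (h2 T hT).symm,
    Finset.sum_congr rfl fun T hT => integral_congr_ae (h1 T hT),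
    Finset.sum_congr rfl fun T hT => integral_congr_ae (h2 T hT), ← Finset.sum_sub_distrib] at hmain
  -- All side means of `v` other than the one on `s` vanish, so at most one term survives.
  have h3 : ∑ s' ∈ 𝒯.sidesIn ΓN, ∫ x in hull s', g x * 𝒯.sideMean v s' ∂(surface d) =
      if s ∈ 𝒯.sidesIn ΓN then ∫ x in hull s, g x ∂(surface d) else 0 := by
    rw [← Finset.sum_ite_eq' (𝒯.sidesIn ΓN) s fun s' => ∫ x in hull s', g x ∂(surface d)]
    refine Finset.sum_congr rfl fun s' hs' => ?_
    rw [hmean s' (sides_of_mem_sidesIn hs')]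
    split_ifs <;> simp
  rw [h3, sub_eq_zero] at hmain
  rw [← hmain, Finset.mul_sum, Finset.sum_filter]
  refine Finset.sum_congr rfl fun T hT => ?_
  have hV := (𝒯.isSimplex hT).measureReal_pos.ne'
  split_ifs with hsT
  · rw [flux, ← (𝒯.isSimplex hT).crBasis_flux hd hsT hsd (c T) (k T) (vertexMean_mem_hull hsn)]
    simp only [integral_const, measureReal_restrict_apply_univ, smul_eq_mul, setAverage_eq]
    field_simp
  · rw [IsSimplex.crBasis_of_not_subset hsT]
    simp

end Triangulation

end FEM

end

/-! ### The lifting lemma. -/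

open FEM FEM.Triangulation in
theorem lemmaA1 {d : ℕ} (hd : 1 ≤ d) (Ω : Set (Eucl d)) (hΩ : interior (closure Ω) = Ω)
    (ΓD ΓN ΓC : Set (Eucl d)) (hΓ : IsBoundaryPartition Ω ΓD ΓN ΓC)
    (𝒯 : Triangulation Ω)
    (h𝒯 : ∀ s ∈ 𝒯.boundarySides, s ∈ 𝒯.sidesIn ΓD ∨ s ∈ 𝒯.sidesIn ΓN ∨ s ∈ 𝒯.sidesIn ΓC)
    (ybar : Eucl d → Eucl d) (hybar : 𝒯.IsElementwiseConst ybar)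
    (f : Eucl d → ℝ) (hf : 𝒯.IsElementwiseConst f)
    (g : Eucl d → ℝ) (hg : IsSidewiseConst (𝒯.sidesIn ΓN) g)
    (hcompat : ∀ v : Eucl d → ℝ, 𝒯.IsCRD ΓD v → (∀ s ∈ 𝒯.sidesIn ΓC, 𝒯.sideMean v s = 0) →
      (∫ x in Ω, inner ℝ (ybar x) (𝒯.brokenGradient v x))
        - (∫ x in Ω, f x * 𝒯.elementMean v x)
        - (∑ s ∈ 𝒯.sidesIn ΓN, ∫ x in hull s, g x * 𝒯.sideMean v s ∂(surface d)) = 0)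
    (y : Eucl d → Eucl d)
    (hy : ∀ᵐ x ∂(volume.restrict Ω),
      y x = ybar x - (f x / (d : ℝ)) • (x - 𝒯.elementMean id x)) :
    𝒯.IsRT y ∧
    (∀ᵐ x ∂(volume.restrict Ω), 𝒯.elementMean y x = ybar x) ∧
    HasWeakDiv Ω y (fun x => - f x) ∧
    (∀ s ∈ 𝒯.sidesIn ΓN, ∀ᵐ x ∂((surface d).restrict (hull s)),
      normalComponent y (𝒯.adjacent s) s x = g x) := by
  classical
  choose! c hc using hybar
  choose! k hk using hf
  let Y : Finset (Eucl d) → Eucl d →ᵃ[ℝ] Eucl d := fun T =>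
    AffineMap.const ℝ (Eucl d) (c T) -
      (k T / d) • (AffineMap.id ℝ (Eucl d) - AffineMap.const ℝ (Eucl d) (barycenter T))
  have hY : ∀ T x, Y T x = c T - (k T / d) • (x - barycenter T) := fun T x => rfl
  have hYc : ∀ T, Continuous (Y T) := fun T => (contDiff_affine _ (m := 0)).continuous
  have hyT : ∀ T ∈ 𝒯.elements, ∀ᵐ x ∂(volume.restrict (hull T)), y x = Y T x := fun T hT => by
    filter_upwards [(ae_restrict_iff hΩ).1 hy T hT, hc T hT, hk T hT,
      elementMean_ae (v := id) (w := fun x => x) hT (Filter.Eventually.of_forall fun x => rfl)]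
      with x h1 h2 h3 h4
    rw [h1, h2, h3, h4, hY]
  have hrestr : ∀ T ∈ 𝒯.elements, restr y T = Y T := fun T hT =>
    restr_eq (𝒯.isSimplex hT) (hyT T hT)
  have hnormal : ∀ s T, 𝒯.IsSideOf s T → ∀ x ∈ hull s, normalComponent y T s x = flux c k T s :=
    fun s T h x hx => by
      obtain ⟨hT, hsT, hs⟩ := h
      rw [normalComponent, hrestr T hT, hY]
      exact inner_outwardNormal_eq_flux (𝒯.isSimplex hT) hd hsT hs c k hx
  have harea : ∀ s T, 𝒯.IsSideOf s T → (surface d).real (hull s) ≠ 0 := fun s T h =>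
    ((𝒯.isSimplex h.1).surface_real_pos hd h.2.1 h.2.2).ne'
  -- Stated for all sides off the boundary, shared or not, so it need not be shown that unshared
  -- sides lie in the boundary.
  have hbalance : ∀ s ∈ 𝒯.sides, s ∉ 𝒯.boundarySides →
      ∑ T ∈ 𝒯.elements with s ⊆ T, flux c k T s = 0 := fun s hs hsb => by
    have hsΓ : ∀ Γ, s ∉ 𝒯.sidesIn Γ := fun Γ h => hsb (mem_sidesIn.1 h).1
    have := sum_flux hd hΩ hc hk hcompat hs (hsΓ _) (hsΓ _)
    rw [if_neg (hsΓ _)] at this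
    exact (mul_eq_zero.1 this).resolve_left (harea s _ (isSideOf_adjacent hs))
  refine ⟨⟨fun T hT => ⟨Y T, hyT T hT⟩, fun s T h => ⟨_, hnormal s T h⟩, ?_⟩, ?_,
    ⟨?_, ?_, ?_⟩, ?_⟩
  · intro s T T' h x hx
    obtain ⟨h1, h2, hne⟩ := id h
    rw [hnormal s T h1 x hx, hnormal s T' h2 x hx,
      ← hbalance s (mem_sides.2 ⟨T, h1⟩) (notMem_boundarySides_of_isSharedSide hΩ hd h),
      ← Finset.sum_pair (f := fun T => flux c k T s) hne]
    refine Finset.sum_congr ?_ fun _ _ => rfl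
    ext T''
    simp only [Finset.mem_insert, Finset.mem_singleton, Finset.mem_filter]
    constructor
    · rintro (rfl | rfl)
      · exact ⟨h1.1, h1.2.1⟩
      · exact ⟨h2.1, h2.2.1⟩
    · exact fun h'' => eq_or_eq_of_isSharedSide hd h ⟨h''.1, h''.2, h1.2.2⟩
  · refine (ae_restrict_iff (𝒯 := 𝒯) hΩ).2 fun T hT => ?_
    filter_upwards [elementMean_ae hT (hyT T hT), hc T hT] with x h1 h2
    rw [h1, h2, (𝒯.isSimplex hT).affine_barycenter, hY, sub_self, smul_zero, sub_zero]
  · refine (memLp_assemble (𝒯 := 𝒯) hYc).ae_eq ?_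
    refine (ae_restrict_iff (𝒯 := 𝒯) hΩ).2 fun T hT => ?_
    filter_upwards [assemble_ae hT fun T => Y T, hyT T hT] with x h1 h2
    rw [h1, h2]
  · refine (memLp_assemble (𝒯 := 𝒯) (G := fun T _ => -k T) fun T => continuous_const).ae_eq ?_
    refine (ae_restrict_iff (𝒯 := 𝒯) hΩ).2 fun T hT => ?_
    filter_upwards [assemble_ae hT fun T _ => -k T, hk T hT] with x h1 h2
    rw [h1, h2]
  · intro φ hφ _ hsupp
    have hφ1 : ContDiff ℝ 1 φ := hφ.of_le (by exact_mod_cast le_top)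
    have hφ' : Continuous (fderiv ℝ φ) := hφ1.continuous_fderiv one_ne_zero
    have hφc : Continuous φ := hφ1.continuous
    have h1 : ∀ T ∈ 𝒯.elements, (fun x => inner ℝ (y x) (gradient φ x))
        =ᵐ[volume.restrict (hull T)] fun x => fderiv ℝ φ x (Y T x) := fun T hT => by
      filter_upwards [hyT T hT] with x hx
      rw [hx, real_inner_comm, gradient, InnerProductSpace.toDual_symm_apply]
    have h2 : ∀ T ∈ 𝒯.elements, (fun x => -f x * φ x)
        =ᵐ[volume.restrict (hull T)] fun x => -k T * φ x := fun T hT => by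
      filter_upwards [hk T hT] with x hx
      rw [hx]
    have i1 : ∀ T, IntegrableOn (fun x => fderiv ℝ φ x (Y T x)) (hull T) := fun T =>
      IsSimplex.integrableOn_hull (hφ'.clm_apply (hYc T))
    have i2 : ∀ T : Finset (Eucl d), IntegrableOn (fun x => -k T * φ x) (hull T) := fun T =>
      IsSimplex.integrableOn_hull (by fun_prop)
    rw [← add_eq_zero_iff_eq_neg,
      setIntegral_eq_sum hΩ fun T hT => (i1 T).congr (h1 T hT).symm,
      setIntegral_eq_sum hΩ fun T hT => (i2 T).congr (h2 T hT).symm,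
      Finset.sum_congr rfl fun T hT => integral_congr_ae (h1 T hT),
      Finset.sum_congr rfl fun T hT => integral_congr_ae (h2 T hT), ← Finset.sum_add_distrib]
    have h3 : ∀ T ∈ 𝒯.elements, (∫ x in hull T, fderiv ℝ φ x (Y T x)) +
        (∫ x in hull T, -k T * φ x) =
        ∑ s ∈ T.powersetCard d, flux c k T s * ∫ x in hull s, φ x ∂(surface d) := fun T hT => by
      rw [← (𝒯.isSimplex hT).divergence_theorem hd (hY T)
        (fun s hsT hs x hx =>
          inner_outwardNormal_eq_flux (𝒯.isSimplex hT) hd hsT hs c k hx) hφ1,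
        ← integral_add (i1 T) (i2 T)]
      simp only [neg_mul, sub_eq_add_neg]
    -- Regrouping by sides collects all fluxes through one side as the factor of a single integral
    -- of `φ`.
    rw [Finset.sum_congr rfl h3, Finset.sum_comm' (t' := 𝒯.sides)
      (s' := fun s => 𝒯.elements.filter fun T => s ⊆ T) (fun T s => ?_)]
    · refine Finset.sum_eq_zero fun s hs => ?_
      rw [← Finset.sum_mul]
      by_cases hsb : s ∈ 𝒯.boundarySides
      · have hfr : hull s ⊆ frontier Ω := (Finset.mem_filter.1 hsb).2
        have hΩo : IsOpen Ω := hΩ ▸ isOpen_interior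
        rw [hΩo.frontier_eq] at hfr
        -- A boundary side is disjoint from the open set `Ω`, which contains the support of `φ`.
        rw [setIntegral_congr_fun (g := fun _ => 0) (isCompact_hull s).measurableSet
          fun x hx => image_eq_zero_of_notMem_tsupport fun h => (hfr hx).2 (hsupp h),
          integral_zero, mul_zero]
      · rw [hbalance s hs hsb, zero_mul]
    · simp only [Finset.mem_powersetCard, Finset.mem_filter, mem_sides, IsSideOf]
      constructor
      · rintro ⟨h1, h2, h3⟩
        exact ⟨⟨h1, h2⟩, T, h1, h2, h3⟩
      · rintro ⟨⟨h1, h2⟩, T', h3, h4, h5⟩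
        exact ⟨h1, h2, h5⟩
  · intro s hsN
    have hs := sides_of_mem_sidesIn hsN
    have hadj := isSideOf_adjacent hs
    have hsn := IsSimplex.nonempty_of_card_eq hd hadj.2.2
    have hsum := sum_flux hd hΩ hc hk hcompat hs
      (notMem_sidesIn_of_disjoint hsn hΓ.disjDN.symm hsN)
      (notMem_sidesIn_of_disjoint hsn hΓ.disjNC hsN)
    -- A second element at `s` would make it a shared side, which is never a boundary side.
    have hfilter : (𝒯.elements.filter fun T => s ⊆ T) = {𝒯.adjacent s} := by
      ext T
      simp only [Finset.mem_filter, Finset.mem_singleton]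
      constructor
      · rintro ⟨h1, h2⟩
        by_contra hne
        exact notMem_boundarySides_of_isSharedSide hΩ hd ⟨⟨h1, h2, hadj.2.2⟩, hadj, hne⟩
          (mem_sidesIn.1 hsN).1
      · rintro rfl
        exact ⟨hadj.1, hadj.2.1⟩
    obtain ⟨γ, hγ⟩ := hg s hsN
    rw [hfilter, Finset.sum_singleton, if_pos hsN, integral_congr_ae hγ] at hsum
    simp only [integral_const, measureReal_restrict_apply_univ, smul_eq_mul] at hsum
    have hflux := mul_left_cancel₀ (harea s _ hadj) hsum
    filter_upwards [hγ, ae_restrict_mem (isCompact_hull s).measurableSet] with x h1 h2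
    rw [hnormal s _ hadj x h2, h1, hflux]
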